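/- **Setting.** Let $K\ge 2$, let $(X,Y)$ take values in $\mathcal X\times\{1,\dots,K\}$ with law $\mathbb P$, let $\mathbb P_X$ be the law of $X$, and let $p_k(x)=\mathbb P(Y=k\mid X=x)$. Put $Z_k=2\cdot\mathbf 1_{\{Y=k\}}-1$. A confidence set is a measurable map $\Gamma:\mathcal X\to 2^{\{1,\dots,K\}}$, with risk $\mathcal R(\Gamma)=\mathbb P(Y\notin\Gamma(X))$. Assume that the distribution function $F_{p_k}$ of $p_k(X)$ is continuous for every $k$. Put $G(t)=\sum_{k=1}^K(1-F_{p_k}(t))$, fix $\beta\in(0,K)$, and let $G^{-1}(\beta)=\inf\{t\in[0,1]:G(t)\le\beta\}$ and $\Gamma^*_\beta(x)=\{k: G(p_k(x))\le\beta\}$ (the oracle $\beta$-set). **Loss.** Let $B,L,c_1,c_2,c_3,\alpha>0$ and $s\ge1$. Let $\phi:\mathbb R\to\mathbb R$ be convex and $L$-Lipschitz on $[-B,B]$, and let $R_\phi(f)=\mathbb E\big[\sum_{k}\phi(Z_kf_k(X))\big]$ for scores $f=(f_1,\dots,f_K)$. Assume that the modulus of convexity $$\delta(\varepsilon)=\inf\Big\{\tfrac{R_\phi(f)+R_\phi(g)}2-R_\phi\big(\tfrac{f+g}2\big)\;:\;\sum_k\mathbb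 E\big[(f_k-g_k)^2(X)\big]\ge\varepsilon^2\Big\},$$ with the infimum over measurable scores $f,g$ with $\|f\|_\infty,\|g\|_\infty\le B$ (and $\inf\emptyset=+\infty$), satisfies $\delta(\varepsilon)\ge c_1\varepsilon^2$ for all $\varepsilon>0$. Let $f^*$ be a minimizer of $R_\phi$ over all measurable scores, with $R_\phi(f^*)$ finite. Assume that $\phi$ is confidence set calibrated at level $\beta$: there is $\delta^*\in\mathbb R$ such that $\{k:f^*_k(X)\ge-\delta^*\}=\Gamma^*_\beta(X)$ almost surely. Assume moreover that almost surely, for every $k$, $$|p_k(X)-G^{-1}(\beta)|^s\le c_3\big[p_k(X)(\phi(-\delta^*)-\phi(f^*_k(X)))+(1-p_k(X))(\phi(\delta^*)-\phi(-f^*_k(X)))\big].$$ Assume finally the margin conditions ${\rm M}^k_\alpha$: $\mathbb P_X(0<|p_k(X)-G^{-1}(\beta)|\le t)\le c_2t^\alpha$ for all $t>0$ and all $k=1,\dots,K$. **Procedure.** Let $2\le V\le n$, $N\ge1$, $M\ge 1$. Let $\mathcal D_n=\{(X_i,Y_i)\}_{i\le n}$ be i.i.d. with law $\mathbb P$, and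 let $\mathcal D_N$ be an independent sample of $N$ i.i.d. unlabeled points with law $\mathbb P_X$. Let $(B_v)_{v\le V}$ be a partition of $\{1,\dots,n\}$ with ${\rm card}(B_v)\in\{\lfloor n/V\rfloor,\lfloor n/V\rfloor+1\}$, and let $P_n^{(-v)}$ be the empirical measure of the points $(X_i,Y_i)$, $i\notin B_v$. A score algorithm maps an empirical distribution to a score. Let $f^1,\dots,f^M$ be score algorithms, let ${\rm conv}(\mathcal F)$ be the set of their convex combinations, and assume that, almost surely, $\|f(P_n^{(-v)})\|_\infty\le B$ for all $f\in{\rm conv}(\mathcal F)$ and all $v$. Let $$\widehat R^n_\phi(f)=\frac1V\sum_v\frac1{{\rm card}(B_v)}\sum_{i\in B_v}\sum_k\phi\big(Z^i_kf_k(P_n^{(-v)})(X_i)\big),\qquad \tilde R^n_\phi(f)=\frac1V\sum_vR_\phi\big(f(P_n^{(-v)})\big),$$ where $Z^i_k=2\cdot\mathbf 1_{\{Y_i=k\}}-1$, and let $\hat f$ and $\tilde f$ (functions of $\mathcal D_n$) minimize $\widehat R^n_\phi$ and $\tilde R^n_\phi$ respectively over ${\rm conv}(\mathcal F)$. Assume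 that, almost surely, $t\mapsto\mathbb P_X\big(\hat f_k(P_n^{(-v)})(X)\le t\mid\mathcal D_n\big)$ is continuous for all $v$ and $k$. For each $v$ let $\hat\Gamma^{{\rm CV},v}_\beta(x)=\{k:\hat G_v(\hat f_k(P_n^{(-v)})(x))\le\beta\}$, where $\hat G_v(t)=\frac1N\sum_{X'\in\mathcal D_N}\sum_k\mathbf 1_{\{\hat f_k(P_n^{(-v)})(X')\ge t\}}$, and put $$\Delta\tilde{\mathcal R}^n(\hat\Gamma^{\rm CV}_\beta)=\frac1V\sum_v\mathcal R(\hat\Gamma^{{\rm CV},v}_\beta)-\mathcal R(\Gamma^*_\beta),\qquad \Delta\tilde R^n_\phi(f)=\tilde R^n_\phi(f)-R_\phi(f^*),$$ where $\mathcal R$ and $R_\phi$ are computed conditionally on the two samples. **Conclusion.** Both excess risks $\Delta\tilde{\mathcal R}^n(\hat\Gamma^{\rm CV}_\beta)$ and $\Delta\tilde R^n_\phi(\tilde f)$ are integrable, and $$\mathbf E\big[|\Delta\tilde{\mathcal R}^n(\hat\Gamma^{\rm CV}_\beta)|\big]\le C\,K^{1-\alpha/(\alpha+s)}\Big\{\mathbf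 E\big[\Delta\tilde R^n_\phi(\tilde f)\big]+\frac{KM\log n}{\lfloor n/V\rfloor}\Big\}^{\alpha/(\alpha+s)}+C'\frac K{\sqrt N},$$ where $C'>0$ is an absolute constant and $C>0$ depends only on $B,L,\alpha,s$ and on the constants $c_1,c_2,c_3$ of the assumptions. -/

import Mathlib

open MeasureTheory ProbabilityTheory

noncomputable section

namespace ConfSet

/-- A (vector of) score functions `f = (f_1, …, f_K) : 𝒳 → ℝ^K`. -/
abbrev Score (𝒳 : Type*) (K : ℕ) := 𝒳 → Fin K → ℝ

/-- A score algorithm maps a distribution on `𝒳 × 𝒴` (in practice an empirical one)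
to a score function. -/
abbrev ScoreAlgorithm (𝒳 : Type*) [MeasurableSpace 𝒳] (K : ℕ) :=
  Measure (𝒳 × Fin K) → Score 𝒳 K

section Population

variable {𝒳 : Type*} [MeasurableSpace 𝒳] {K : ℕ}

/-- `p_k(x) = ℙ(Y = k | X = x)`. -/
def condProb [NeZero K] (P : Measure (𝒳 × Fin K)) [IsFiniteMeasure P] : Score 𝒳 K :=
  fun x k => (P.condKernel x).real {k}

/-- The cumulative distribution function of `f_k(X)`, where `X` has law `P.fst`. -/
def scoreCDF (P : Measure (𝒳 × Fin K)) (f : Score 𝒳 K) (k : Fin K) (t : ℝ) : ℝ :=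
  P.fst.real {x | f x k ≤ t}

/-- `G_f(t) = ∑_k (1 - F_{f_k}(t))`. -/
def tailSum (P : Measure (𝒳 × Fin K)) (f : Score 𝒳 K) (t : ℝ) : ℝ :=
  ∑ k, (1 - scoreCDF P f k t)

/-- The generalized inverse `G⁻¹(β) = inf {t ∈ [0,1] : G(t) ≤ β}`, with `G = G_p`. -/
def tailInv [NeZero K] (P : Measure (𝒳 × Fin K)) [IsFiniteMeasure P] (β : ℝ) : ℝ :=
  sInf {t : ℝ | t ∈ Set.Icc (0 : ℝ) 1 ∧ tailSum P (condProb P) t ≤ β}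

/-- The confidence set `x ↦ {k : H(f_k(x)) ≤ β}`. -/
def levelSet (H : ℝ → ℝ) (f : Score 𝒳 K) (β : ℝ) (x : 𝒳) : Set (Fin K) :=
  {k | H (f x k) ≤ β}

/-- The oracle `β`-set `Γ*_β(x) = {k : G(p_k(x)) ≤ β}`. -/
def oracleSet [NeZero K] (P : Measure (𝒳 × Fin K)) [IsFiniteMeasure P] (β : ℝ) :
    𝒳 → Set (Fin K) :=
  levelSet (tailSum P (condProb P)) (condProb P) β

/-- The confidence set `Γ_{f,δ}(x) = {k : f_k(x) ≥ -δ}`. -/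
def thresholdSet (f : Score 𝒳 K) (δ : ℝ) (x : 𝒳) : Set (Fin K) :=
  {k | -δ ≤ f x k}

/-- The risk `ℛ(Γ) = ℙ(Y ∉ Γ(X))`. -/
def risk (P : Measure (𝒳 × Fin K)) (Γ : 𝒳 → Set (Fin K)) : ℝ :=
  P.real {z | z.2 ∉ Γ z.1}

/-- `Z_k = 2 · 1{Y = k} - 1`. -/
def labelSign (y k : Fin K) : ℝ := 2 * (if y = k then 1 else 0) - 1

/-- The loss `∑_k φ(Z_k f_k(X))` at the point `z = (X, Y)`. -/
def scoreLoss (φ : ℝ → ℝ) (f : Score 𝒳 K) (z : 𝒳 × Fin K) : ℝ :=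
  ∑ k, φ (labelSign z.2 k * f z.1 k)

/-- The `φ`-risk `R_φ(f) = 𝔼[∑_k φ(Z_k f_k(X))]`. -/
def phiRisk (P : Measure (𝒳 × Fin K)) (φ : ℝ → ℝ) (f : Score 𝒳 K) : ℝ :=
  ∫ z, scoreLoss φ f z ∂P

/-- `f` minimizes the `φ`-risk over all measurable scores.
The integrability clauses say that the risks being compared are finite. -/
def IsPhiRiskMinimizer (P : Measure (𝒳 × Fin K)) (φ : ℝ → ℝ) (f : Score 𝒳 K) : Prop :=
  Measurable f ∧ Integrable (scoreLoss φ f) P ∧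
    ∀ g : Score 𝒳 K, Measurable g → Integrable (scoreLoss φ g) P →
      phiRisk P φ f ≤ phiRisk P φ g

/-- The marginal conditional excess `φ`-risk at `x` of the constant score value `t` for label `k`:
`p_k(x) (φ(t) - φ(f*_k(x))) + (1 - p_k(x)) (φ(-t) - φ(-f*_k(x)))`. -/
def marginalExcess [NeZero K] (P : Measure (𝒳 × Fin K)) [IsFiniteMeasure P] (φ : ℝ → ℝ)
    (fstar : Score 𝒳 K) (k : Fin K) (t : ℝ) (x : 𝒳) : ℝ :=
  condProb P x k * (φ t - φ (fstar x k)) + (1 - condProb P x k) * (φ (-t) - φ (-fstar x k))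

/-- `‖f‖_∞ ≤ B` (essential supremum with respect to the law of `X`). -/
def SupBounded (P : Measure (𝒳 × Fin K)) (B : ℝ) (f : Score 𝒳 K) : Prop :=
  ∀ᵐ x ∂P.fst, ∀ k, |f x k| ≤ B

/-- The modulus of convexity `δ(ε)` of `R_φ` over the measurable scores bounded by `B`:
the infimum of `(R_φ(f) + R_φ(g))/2 - R_φ((f+g)/2)` over the pairs with
`∑_k 𝔼[(f_k - g_k)²(X)] ≥ ε²`. It is `EReal`-valued, so that the infimum of the empty set
is `+∞`. -/
def convexityModulus (P : Measure (𝒳 × Fin K)) (φ : ℝ → ℝ) (B ε : ℝ) : EReal :=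
  sInf {r : EReal | ∃ f g : Score 𝒳 K, Measurable f ∧ Measurable g ∧
    SupBounded P B f ∧ SupBounded P B g ∧
    ε ^ 2 ≤ ∑ k, ∫ x, (f x k - g x k) ^ 2 ∂P.fst ∧
    r = (((phiRisk P φ f + phiRisk P φ g) / 2
      - phiRisk P φ (fun x k => (f x k + g x k) / 2) : ℝ) : EReal)}

/-- The margin condition `M_α^k` with constant `c`:
`ℙ_X(0 < |p_k(X) - G⁻¹(β)| ≤ t) ≤ c t^α` for all `t > 0`. -/
def MarginCondition [NeZero K] (P : Measure (𝒳 × Fin K)) [IsFiniteMeasure P] (β α c : ℝ)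
    (k : Fin K) : Prop :=
  ∀ t : ℝ, 0 < t →
    P.fst.real {x | 0 < |condProb P x k - tailInv P β| ∧ |condProb P x k - tailInv P β| ≤ t}
      ≤ c * t ^ α

end Population

section CrossValidation

variable {𝒳 : Type*} [MeasurableSpace 𝒳] {K n V M N : ℕ}

/-- The convex combination `∑_j m_j f^j` of score algorithms. -/
def combine (A : Fin M → ScoreAlgorithm 𝒳 K) (m : Fin M → ℝ) : ScoreAlgorithm 𝒳 K :=
  fun Q x k => ∑ j, m j * A j Q x k

/-- The block `B_v` of the partition of the sample indices given by `fold`. -/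
def block (fold : Fin n → Fin V) (v : Fin V) : Finset (Fin n) :=
  Finset.univ.filter fun i => fold i = v

/-- A regular partition: every block has `⌊n/V⌋` or `⌊n/V⌋ + 1` elements. -/
def IsRegularPartition (fold : Fin n → Fin V) : Prop :=
  ∀ v, (block fold v).card = n / V ∨ (block fold v).card = n / V + 1

/-- The empirical measure of the points `d i`, `i ∈ S`. -/
def empiricalMeasure (d : Fin n → 𝒳 × Fin K) (S : Finset (Fin n)) : Measure (𝒳 × Fin K) :=
  (S.card : ENNReal)⁻¹ • ∑ i ∈ S, Measure.dirac (d i)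

/-- `P_n^{(-v)}`, the empirical measure of the points outside the block `B_v`. -/
def trainMeasure (fold : Fin n → Fin V) (d : Fin n → 𝒳 × Fin K) (v : Fin V) :
    Measure (𝒳 × Fin K) :=
  empiricalMeasure d (block fold v)ᶜ

/-- The score `f(P_n^{(-v)})` for the algorithm `f = ∑_j m_j f^j`. -/
def foldScore (A : Fin M → ScoreAlgorithm 𝒳 K) (fold : Fin n → Fin V)
    (d : Fin n → 𝒳 × Fin K) (m : Fin M → ℝ) (v : Fin V) : Score 𝒳 K :=
  combine A m (trainMeasure fold d v)

/-- The cross-validated empirical `φ`-risk of `f = ∑_j m_j f^j`. -/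
def cvEmpRisk (φ : ℝ → ℝ) (A : Fin M → ScoreAlgorithm 𝒳 K) (fold : Fin n → Fin V)
    (d : Fin n → 𝒳 × Fin K) (m : Fin M → ℝ) : ℝ :=
  1 / (V : ℝ) * ∑ v, 1 / ((block fold v).card : ℝ) *
    ∑ i ∈ block fold v, scoreLoss φ (foldScore A fold d m v) (d i)

/-- The oracle counterpart of the cross-validated `φ`-risk of `f = ∑_j m_j f^j`. -/
def cvOracleRisk (P : Measure (𝒳 × Fin K)) (φ : ℝ → ℝ) (A : Fin M → ScoreAlgorithm 𝒳 K)
    (fold : Fin n → Fin V) (d : Fin n → 𝒳 × Fin K) (m : Fin M → ℝ) : ℝ :=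
  1 / (V : ℝ) * ∑ v, phiRisk P φ (foldScore A fold d m v)

/-- `m` is a vector of convex weights that minimizes `R` over all convex weights. -/
def IsConvArgmin (R : (Fin M → ℝ) → ℝ) (m : Fin M → ℝ) : Prop :=
  m ∈ stdSimplex ℝ (Fin M) ∧ ∀ m' ∈ stdSimplex ℝ (Fin M), R m ≤ R m'

/-- `Ĝ(t) = (1/N) ∑_i ∑_k 1{f_k(X_i) ≥ t}` on the unlabeled sample `u`. -/
def empTailSum (u : Fin N → 𝒳) (f : Score 𝒳 K) (t : ℝ) : ℝ :=
  1 / (N : ℝ) * ∑ i, ∑ k, if t ≤ f (u i) k then 1 else 0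

/-- The empirical `β`-set `x ↦ {k : Ĝ(f_k(x)) ≤ β}` of the score `f`, with `Ĝ` computed from
`f` on the unlabeled sample `u`. -/
def empConfSet (u : Fin N → 𝒳) (f : Score 𝒳 K) (β : ℝ) : 𝒳 → Set (Fin K) :=
  levelSet (empTailSum u f) f β

/-- The cross-validated excess risk of the empirical `β`-set of `f = ∑_j m_j f^j`:
`(1/V) ∑_v ℛ(empirical β-set of f(P_n^{(-v)})) - ℛ(Γ*_β)`. -/
def cvExcessRisk [NeZero K] (P : Measure (𝒳 × Fin K)) [IsFiniteMeasure P] (β : ℝ)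
    (A : Fin M → ScoreAlgorithm 𝒳 K) (fold : Fin n → Fin V) (d : Fin n → 𝒳 × Fin K)
    (u : Fin N → 𝒳) (m : Fin M → ℝ) : ℝ :=
  1 / (V : ℝ) * ∑ v, risk P (empConfSet u (foldScore A fold d m v) β) - risk P (oracleSet P β)

/-- The cross-validated excess `φ`-risk of `f = ∑_j m_j f^j`:
`(1/V) ∑_v R_φ(f(P_n^{(-v)})) - R_φ(f*)`. -/
def cvExcessPhiRisk (P : Measure (𝒳 × Fin K)) (φ : ℝ → ℝ) (fstar : Score 𝒳 K)
    (A : Fin M → ScoreAlgorithm 𝒳 K) (fold : Fin n → Fin V) (d : Fin n → 𝒳 × Fin K)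
    (m : Fin M → ℝ) : ℝ :=
  cvOracleRisk P φ A fold d m - phiRisk P φ fstar

end CrossValidation

end ConfSet

end

/-! Three errors are controlled separately: estimating the threshold from unlabeled data,
thresholding a score other than `fstar`, and aggregating by the empirical rather than the oracle
criterion.

Threshold. Let a score `f` with continuous marginals be fixed, let G be its tail sum and choose `t₀`
with G(`t₀`) = β. The empirical β-set and {k : f_k ≥ `t₀`} can disagree at (x, k) only if the
empirical tail errs at the point f_k(x) by at least |G(f_k(x)) - β|. For fixed x this is an event
about one deterministic level, so Chebyshev suffices and no uniform deviation bound is needed. Under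
the summed law of the scores, the band |G - β| ≤ δ has mass at most 2δ, and integrating the
Chebyshev bound against that law gives 4K/√N (`lintegral_abs_risk_empConfSet_sub_le`).

Calibration and margin. The sets {f_k ≥ `t₀`} and the oracle sets both have total mass β, so the two
halves of their symmetric difference weigh the same and it is enough to bound one. According to the
order of `t₀` and -δ*, one half consists of points where -δ* lies between f*_k and f_k. There
convexity carries the calibration inequality from the score -δ* to the score f_k. Points where p_k
is within t of the threshold are handled by the margin condition, the others by Markov's inequality.
The resulting bound is K c₂ t^α plus c₃ t^(-s) times the excess φ-risk, up to a factor 2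
(`sum_symmDiff_thresholdSet_le`).

Aggregation. On a block, the scores depend only on the data outside it, so the block points act as a
fresh sample. The excess loss of one convex combination over another has second moment at most L²K
times their squared distance, so a Bernstein bound penalized by c₁ times that distance has
exponential moment at most one. A grid of mesh 1/n on the weights and a soft maximum over pairs of
grid points cost a logarithm of order M log n. Strong convexity at the oracle minimizer bounds the
penalty by half of the excess being estimated, which is moved to the other side. This yields the
fast rate K M log n / ⌊n/V⌋ (`integral_cvOracleRisk_sub_le_log`).

For each t the conditional risk bound is affine in the excess φ-risk. It is therefore integrated
first, and one deterministic t is then chosen to balance the two terms. -/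

namespace ConfSet

/-! ### Tail sums of a score and the mass of their level bands -/

section TailFunction

variable {𝒳 : Type*} [MeasurableSpace 𝒳] {K : ℕ}

/-- The sum over `k` of the laws of the scores `f_k(X)`. -/
noncomputable def scoreLaw (P : Measure (𝒳 × Fin K)) (f : Score 𝒳 K) : Measure ℝ :=
  ∑ k, P.fst.map fun x => f x k

theorem measurable_score_apply {f : Score 𝒳 K} (hf : Measurable f) (k : Fin K) :
    Measurable fun x => f x k :=
  (measurable_pi_apply k).comp hf

instance scoreLaw.instIsFiniteMeasure (P : Measure (𝒳 × Fin K)) [IsFiniteMeasure P]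
    (f : Score 𝒳 K) : IsFiniteMeasure (scoreLaw P f) := by
  unfold scoreLaw; infer_instance

theorem scoreLaw_apply (P : Measure (𝒳 × Fin K)) {f : Score 𝒳 K} (hf : Measurable f)
    {S : Set ℝ} (hS : MeasurableSet S) :
    scoreLaw P f S = ∑ k, P.fst {x | f x k ∈ S} := by
  simp only [scoreLaw, Measure.coe_finsetSum, Finset.sum_apply]
  exact Finset.sum_congr rfl fun k _ => Measure.map_apply (measurable_score_apply hf k) hS

theorem continuous_tailSum {P : Measure (𝒳 × Fin K)} {f : Score 𝒳 K} (hc : ∀ k, Continuous (scoreCDF P f k)) :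
    Continuous (tailSum P f) :=
  continuous_finsetSum _ fun k _ => continuous_const.sub (hc k)

variable (P : Measure (𝒳 × Fin K)) [IsProbabilityMeasure P]

theorem scoreLaw_real_apply {f : Score 𝒳 K} (hf : Measurable f)
    {S : Set ℝ} (hS : MeasurableSet S) :
    (scoreLaw P f).real S = ∑ k, P.fst.real {x | f x k ∈ S} := by
  rw [measureReal_def, scoreLaw_apply P hf hS, ENNReal.toReal_sum fun _ _ => measure_ne_top _ _]
  rfl

theorem scoreCDF_eq_cdf {f : Score 𝒳 K} (hf : Measurable f) (k : Fin K) :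
    scoreCDF P f k = cdf (P.fst.map fun x => f x k) := by
  have := Measure.isProbabilityMeasure_map (μ := P.fst) (measurable_score_apply hf k).aemeasurable
  ext t
  rw [cdf_eq_real, measureReal_def,
    Measure.map_apply (measurable_score_apply hf k) measurableSet_Iic]
  rfl

variable {P}

theorem measure_score_eq_zero {f : Score 𝒳 K} (hf : Measurable f) {k : Fin K}
    (hc : Continuous (scoreCDF P f k)) (t : ℝ) : P.fst {x | f x k = t} = 0 := by
  have := Measure.isProbabilityMeasure_map (μ := P.fst) (measurable_score_apply hf k).aemeasurable
  have h : (P.fst.map fun x => f x k) {t} = 0 := by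
    rw [← measure_cdf (P.fst.map fun x => f x k), StieltjesFunction.measure_singleton,
      ← scoreCDF_eq_cdf P hf, hc.continuousAt.continuousWithinAt.leftLim_eq, sub_self,
      ENNReal.ofReal_zero]
  rwa [Measure.map_apply (measurable_score_apply hf k) (measurableSet_singleton t)] at h

theorem nullSingletonClass_scoreLaw {f : Score 𝒳 K} (hf : Measurable f)
    (hc : ∀ k, Continuous (scoreCDF P f k)) : NullSingletonClass (scoreLaw P f) :=
  ⟨fun t => by
    rw [scoreLaw_apply P hf (measurableSet_singleton t)]
    exact Finset.sum_eq_zero fun k _ => measure_score_eq_zero hf (hc k) t⟩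

theorem tailSum_eq_sum_real {f : Score 𝒳 K} (hf : Measurable f) (t : ℝ) :
    tailSum P f t = ∑ k, P.fst.real {x | t < f x k} := by
  refine Finset.sum_congr rfl fun k _ => ?_
  have h := measureReal_compl (μ := P.fst) (s := {x | f x k ≤ t})
    (measurableSet_le (measurable_score_apply hf k) measurable_const)
  rw [probReal_univ] at h
  rw [scoreCDF, ← h]
  congr 1
  ext x; simp

theorem tailSum_eq_scoreLaw_Ioi {f : Score 𝒳 K} (hf : Measurable f) (t : ℝ) :
    tailSum P f t = (scoreLaw P f).real (Set.Ioi t) := by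
  rw [tailSum_eq_sum_real hf, scoreLaw_real_apply P hf measurableSet_Ioi]
  rfl

/-- The empirical tail counts weak exceedances and the population tail strict ones; without atoms
the two conventions agree. -/
theorem tailSum_eq_sum_le {f : Score 𝒳 K} (hf : Measurable f)
    (hc : ∀ k, Continuous (scoreCDF P f k)) (t : ℝ) :
    tailSum P f t = ∑ k, P.fst.real {x | t ≤ f x k} := by
  have := nullSingletonClass_scoreLaw hf hc
  rw [tailSum_eq_scoreLaw_Ioi hf, measureReal_congr Ioi_ae_eq_Ici,
    scoreLaw_real_apply P hf measurableSet_Ici]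
  rfl

theorem antitone_tailSum {f : Score 𝒳 K} (hf : Measurable f) : Antitone (tailSum P f) := by
  intro a b hab
  rw [tailSum_eq_scoreLaw_Ioi hf, tailSum_eq_scoreLaw_Ioi hf]
  exact measureReal_mono (Set.Ioi_subset_Ioi hab)

/-- G is itself the tail of the law that measures the band, so the mass between two points of the
band is a difference of two values of G, both within δ of β. Inner regularity supplies extreme
points that belong to the set, even though the band may be unbounded. -/
theorem scoreLaw_band_le {f : Score 𝒳 K} (hf : Measurable f)
    (hc : ∀ k, Continuous (scoreCDF P f k)) (β δ : ℝ) :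
    scoreLaw P f {t | |tailSum P f t - β| ≤ δ} ≤ ENNReal.ofReal (2 * δ) := by
  have := nullSingletonClass_scoreLaw hf hc
  have hG := continuous_tailSum hc
  have hS : MeasurableSet {t | |tailSum P f t - β| ≤ δ} :=
    measurableSet_le (hG.sub continuous_const).abs.measurable measurable_const
  rw [hS.measure_eq_iSup_isCompact]
  refine iSup_le fun C => iSup_le fun hCS => iSup_le fun hC => ?_
  rcases C.eq_empty_or_nonempty with rfl | hne
  · simp
  obtain ⟨a, ha⟩ := hC.exists_isLeast hne
  obtain ⟨b, hb⟩ := hC.exists_isGreatest hne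
  have hsub : C ⊆ Set.Icc a b := fun x hx => ⟨ha.2 hx, hb.2 hx⟩
  calc scoreLaw P f C ≤ scoreLaw P f (Set.Icc a b) := measure_mono hsub
    _ = scoreLaw P f (Set.Ioc a b) := measure_congr Ioc_ae_eq_Icc.symm
    _ = ENNReal.ofReal ((scoreLaw P f).real (Set.Ioc a b)) := by
        rw [ofReal_measureReal]
    _ ≤ ENNReal.ofReal (2 * δ) := by
        refine ENNReal.ofReal_le_ofReal ?_
        have h1 : (scoreLaw P f).real (Set.Ioc a b) = tailSum P f a - tailSum P f b := by
          rw [tailSum_eq_scoreLaw_Ioi hf, tailSum_eq_scoreLaw_Ioi hf,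
            ← measureReal_sdiff (Set.Ioi_subset_Ioi (ha.2 hb.1)) measurableSet_Ioi,
            Set.Ioi_sdiff_Ioi]
        have h2 : |tailSum P f a - β| ≤ δ := hCS ha.1
        have h3 : |tailSum P f b - β| ≤ δ := hCS hb.1
        rw [h1]
        linarith [(abs_le.1 h2).2, (abs_le.1 h3).1]

/-- Intermediate value theorem between the limits K at -∞ and 0 at +∞. The solution is the
population threshold that gives the score a mean set size of β. -/
theorem exists_tailSum_eq {f : Score 𝒳 K} (hf : Measurable f)
    (hc : ∀ k, Continuous (scoreCDF P f k)) {β : ℝ} (h0 : 0 < β) (hK : β < K) :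
    ∃ t, tailSum P f t = β := by
  have hprob := fun k => Measure.isProbabilityMeasure_map (μ := P.fst)
    (measurable_score_apply hf k).aemeasurable
  have htop : Filter.Tendsto (tailSum P f) Filter.atTop (nhds 0) := by
    have : Filter.Tendsto (tailSum P f) Filter.atTop (nhds (∑ _k : Fin K, (1 - 1 : ℝ))) := by
      refine tendsto_finsetSum _ fun k _ => tendsto_const_nhds.sub ?_
      rw [scoreCDF_eq_cdf P hf]
      exact tendsto_cdf_atTop _
    simpa using this
  have hbot : Filter.Tendsto (tailSum P f) Filter.atBot (nhds K) := by
    have : Filter.Tendsto (tailSum P f) Filter.atBot (nhds (∑ _k : Fin K, (1 - 0 : ℝ))) := by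
      refine tendsto_finsetSum _ fun k _ => tendsto_const_nhds.sub ?_
      rw [scoreCDF_eq_cdf P hf]
      exact tendsto_cdf_atBot _
    simpa using this
  exact mem_range_of_exists_le_of_exists_ge (continuous_tailSum hc)
    ((htop.eventually (eventually_le_nhds h0)).exists)
    ((hbot.eventually (eventually_ge_nhds hK)).exists)

/-- The sets {G ≤ β} and (t, ∞) with G(t) = β differ only on the plateau {G = β}, which is a band of
width zero and hence null. Applied to the p_k, this says that the oracle set has mean size exactly
β. -/
theorem sum_measure_levelSet {f : Score 𝒳 K} (hf : Measurable f)
    (hc : ∀ k, Continuous (scoreCDF P f k)) {β : ℝ} (h0 : 0 < β) (hK : β < K) :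
    ∑ k, P.fst.real {x | k ∈ levelSet (tailSum P f) f β x} = β := by
  have := nullSingletonClass_scoreLaw hf hc
  have hG := continuous_tailSum hc
  have hanti := antitone_tailSum (P := P) hf
  obtain ⟨t, ht⟩ := exists_tailSum_eq hf hc h0 hK
  have hS : MeasurableSet {s | tailSum P f s ≤ β} := measurableSet_le hG.measurable measurable_const
  have h1 : ∑ k, P.fst.real {x | k ∈ levelSet (tailSum P f) f β x}
      = (scoreLaw P f).real {s | tailSum P f s ≤ β} := by
    rw [scoreLaw_real_apply P hf hS]; rfl
  have hnull : scoreLaw P f {s | |tailSum P f s - β| ≤ 0} = 0 := by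
    simpa using scoreLaw_band_le hf hc β 0
  have hae : {s | tailSum P f s ≤ β} =ᵐ[scoreLaw P f] Set.Ioi t := by
    have : ∀ᵐ s ∂(scoreLaw P f), ¬ |tailSum P f s - β| ≤ 0 := measure_eq_zero_iff_ae_notMem.1 hnull
    filter_upwards [this] with s hs
    refine propext ⟨fun h => ?_, fun h => ?_⟩
    · change tailSum P f s ≤ β at h
      change t < s
      by_contra hlt
      have := hanti (not_lt.1 hlt)
      exact hs (by rw [le_antisymm h (by linarith)]; simp)
    · exact (hanti (le_of_lt (Set.mem_Ioi.1 h))).trans ht.le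
  rw [h1, measureReal_congr hae, ← tailSum_eq_scoreLaw_Ioi hf, ht]

end TailFunction

/-! ### Comparing the risks of two confidence sets -/

section Risk

variable {𝒳 : Type*} [MeasurableSpace 𝒳] {K : ℕ} {P : Measure (𝒳 × Fin K)}

theorem fst_real_apply {S : Set 𝒳} (hS : MeasurableSet S) :
    P.fst.real S = P.real (Prod.fst ⁻¹' S) := by
  rw [measureReal_def, Measure.fst_apply hS, measureReal_def]

theorem measurableSet_of_forall_label {S : Set (𝒳 × Fin K)}
    (h : ∀ k, MeasurableSet {x | (x, k) ∈ S}) : MeasurableSet S := by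
  have : S = ⋃ k, {x | (x, k) ∈ S} ×ˢ {k} := by
    ext ⟨x, k⟩; simp
  rw [this]
  exact MeasurableSet.iUnion fun k => (h k).prod (measurableSet_singleton k)

/-- Only a disagreement at k = Y changes the error event; forgetting this constraint and taking a
union bound over labels leaves quantities that involve X alone. -/
theorem abs_risk_sub_le [IsProbabilityMeasure P] {Γ Γ' : 𝒳 → Set (Fin K)} (h : ∀ k, MeasurableSet {x | k ∈ Γ x})
    (h' : ∀ k, MeasurableSet {x | k ∈ Γ' x}) :
    |risk P Γ - risk P Γ'| ≤ ∑ k, P.fst.real {x | ¬ (k ∈ Γ x ↔ k ∈ Γ' x)} := by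
  have m1 : MeasurableSet {z : 𝒳 × Fin K | z.2 ∉ Γ z.1} :=
    measurableSet_of_forall_label fun k => (h k).compl
  have m2 : MeasurableSet {z : 𝒳 × Fin K | z.2 ∉ Γ' z.1} :=
    measurableSet_of_forall_label fun k => (h' k).compl
  have m3 : ∀ k, MeasurableSet {x | ¬ (k ∈ Γ x ↔ k ∈ Γ' x)} := fun k => ((h k).iff (h' k)).compl
  refine (abs_measureReal_sub_le_measureReal_symmDiff m1.nullMeasurableSet
    m2.nullMeasurableSet).trans ?_
  simp_rw [fun k => fst_real_apply (P := P) (m3 k)]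
  refine le_trans (measureReal_mono ?_ (measure_ne_top _ _)) (measureReal_biUnion_finset_le Finset.univ
    fun k => Prod.fst ⁻¹' {x | ¬ (k ∈ Γ x ↔ k ∈ Γ' x)})
  rintro ⟨x, k⟩ hz
  simp only [Set.mem_iUnion, Finset.mem_univ, exists_prop, true_and]
  refine ⟨k, fun hiff => ?_⟩
  rcases hz with ⟨h1, h2⟩ | ⟨h1, h2⟩ <;> simp_all

end Risk

/-! ### Estimating the threshold from the unlabeled sample -/

section EmpiricalTail

variable {𝒳 : Type*} {K N : ℕ}

theorem exceedCount_mem_Icc (f : Score 𝒳 K) (t : ℝ) (x : 𝒳) :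
    (∑ k, if t ≤ f x k then (1 : ℝ) else 0) ∈ Set.Icc 0 (K : ℝ) := by
  refine ⟨Finset.sum_nonneg fun k _ => by split_ifs <;> simp, ?_⟩
  calc (∑ k, if t ≤ f x k then (1 : ℝ) else 0) ≤ ∑ _k : Fin K, (1 : ℝ) :=
        Finset.sum_le_sum fun k _ => by split_ifs <;> simp
    _ = K := by simp

theorem measurable_empTailSum_uncurry {Ω : Type*} [MeasurableSpace Ω] {u : Ω → Fin N → 𝒳}
    {f : Ω → Score 𝒳 K} {t : Ω → ℝ} (ht : Measurable t)
    (hf : ∀ i k, Measurable fun ω => f ω (u ω i) k) :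
    Measurable fun ω => empTailSum (u ω) (f ω) (t ω) := by
  unfold empTailSum
  refine measurable_const.mul (Finset.measurable_sum _ fun i _ => Finset.measurable_sum _ fun k _ =>
    Measurable.ite (measurableSet_le ht (hf i k)) measurable_const measurable_const)

variable [MeasurableSpace 𝒳] {P : Measure (𝒳 × Fin K)}

theorem measurable_exceedCount {f : Score 𝒳 K} (hf : Measurable f) (t : ℝ) :
    Measurable fun x => ∑ k, if t ≤ f x k then (1 : ℝ) else 0 :=
  Finset.measurable_sum _ fun k _ =>
    Measurable.ite (measurableSet_le measurable_const (measurable_score_apply hf k))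
      measurable_const measurable_const

theorem memLp_exceedCount [IsProbabilityMeasure P] {f : Score 𝒳 K} (hf : Measurable f) (t : ℝ)
    (p : ENNReal) :
    MemLp (fun x => ∑ k, if t ≤ f x k then (1 : ℝ) else 0) p P.fst := by
  refine MemLp.of_bound (measurable_exceedCount hf t).aestronglyMeasurable (K : ℝ)
    (Filter.Eventually.of_forall fun x => ?_)
  rw [Real.norm_eq_abs, abs_of_nonneg (exceedCount_mem_Icc f t x).1]
  exact (exceedCount_mem_Icc f t x).2

theorem integral_exceedCount [IsProbabilityMeasure P] {f : Score 𝒳 K} (hf : Measurable f)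
    (hc : ∀ k, Continuous (scoreCDF P f k)) (t : ℝ) :
    ∫ x, (∑ k, if t ≤ f x k then (1 : ℝ) else 0) ∂P.fst = tailSum P f t := by
  have hm : ∀ k, MeasurableSet {x | t ≤ f x k} := fun k =>
    measurableSet_le measurable_const (measurable_score_apply hf k)
  have he : ∀ k, (fun x => if t ≤ f x k then (1 : ℝ) else 0)
      = Set.indicator {x | t ≤ f x k} fun _ => (1 : ℝ) := by
    intro k; ext x; simp [Set.indicator_apply]
  rw [integral_finsetSum, tailSum_eq_sum_le hf hc]
  · refine Finset.sum_congr rfl fun k _ => ?_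
    rw [he, integral_indicator_const _ (hm k)]
    simp
  · intro k _
    rw [he]
    exact (integrable_const _).indicator (hm k)

/-- Each summand counts labels and lies in [0, K], so its variance is at most K²/4 (Popoviciu);
independence divides this by N. -/
theorem variance_empTailSum_le [IsProbabilityMeasure P] (hN : 1 ≤ N) {f : Score 𝒳 K}
    (hf : Measurable f) (t : ℝ) :
    Var[fun u : Fin N → 𝒳 => empTailSum u f t; Measure.pi fun _ => P.fst]
      ≤ (K / (2 * Real.sqrt N)) ^ 2 := by
  have hN' : (0 : ℝ) < N := by exact_mod_cast hN
  have h1 : (fun u : Fin N → 𝒳 => empTailSum u f t)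
      = fun u => (1 / (N : ℝ)) * (∑ i : Fin N, fun u : Fin N → 𝒳 =>
          ∑ k, if t ≤ f (u i) k then (1 : ℝ) else 0) u := by
    ext u; simp [empTailSum, Finset.sum_apply]
  rw [h1, variance_const_mul, variance_sum_pi fun _ => memLp_exceedCount hf t 2]
  have h2 := variance_le_sq_of_bounded (μ := P.fst)
    (Filter.Eventually.of_forall fun x => exceedCount_mem_Icc f t x)
    (measurable_exceedCount hf t).aemeasurable
  calc (1 / (N : ℝ)) ^ 2 * ∑ _i : Fin N, Var[fun x => ∑ k, if t ≤ f x k then (1 : ℝ) else 0; P.fst]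
      ≤ (1 / (N : ℝ)) ^ 2 * ∑ _i : Fin N, ((K - 0) / 2 : ℝ) ^ 2 := by gcongr
    _ = (K / (2 * Real.sqrt N)) ^ 2 := by
        rw [Finset.sum_const, Finset.card_univ, Fintype.card_fin, nsmul_eq_mul, div_pow (K : ℝ), mul_pow 2,
          Real.sq_sqrt hN'.le]
        field_simp
        ring

theorem integral_empTailSum [IsProbabilityMeasure P] (hN : 1 ≤ N) {f : Score 𝒳 K}
    (hf : Measurable f) (hc : ∀ k, Continuous (scoreCDF P f k)) (t : ℝ) :
    ∫ u : Fin N → 𝒳, empTailSum u f t ∂(Measure.pi fun _ => P.fst) = tailSum P f t := by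
  have hN' : (N : ℝ) ≠ 0 := by positivity
  have hi : Integrable (fun x => ∑ k, if t ≤ f x k then (1 : ℝ) else 0) P.fst :=
    (memLp_exceedCount hf t 1).integrable le_rfl
  have hmp := fun i : Fin N => measurePreserving_eval (fun _ : Fin N => P.fst) i
  have h2 : ∀ i : Fin N, ∫ u : Fin N → 𝒳, (∑ k, if t ≤ f (u i) k then (1 : ℝ) else 0)
      ∂(Measure.pi fun _ => P.fst) = tailSum P f t := by
    intro i
    have h := integral_map (μ := Measure.pi fun _ : Fin N => P.fst)
      (hmp i).measurable.aemeasurable (by rw [(hmp i).map_eq]; exact hi.aestronglyMeasurable)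
    rw [(hmp i).map_eq, integral_exceedCount hf hc] at h
    exact h.symm
  simp only [empTailSum]
  rw [integral_const_mul, integral_finsetSum]
  · simp only [h2, Finset.sum_const, Finset.card_univ, Fintype.card_fin, nsmul_eq_mul]
    field_simp
  · intro i _
    exact (hmp i).integrable_comp_of_integrable hi

theorem memLp_empTailSum [IsProbabilityMeasure P] {f : Score 𝒳 K} (hf : Measurable f) (t : ℝ) :
    MemLp (fun u : Fin N → 𝒳 => empTailSum u f t) 2 (Measure.pi fun _ => P.fst) := by
  have h : ∀ i : Fin N, MemLp (fun u : Fin N → 𝒳 => ∑ k, if t ≤ f (u i) k then (1 : ℝ) else 0) 2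
      (Measure.pi fun _ => P.fst) := fun i =>
    (memLp_exceedCount hf t 2).comp_measurePreserving
      (measurePreserving_eval (fun _ : Fin N => P.fst) i)
  exact (memLp_finsetSum Finset.univ fun i _ => h i).const_mul (1 / (N : ℝ))

/-- A Cauchy-type tail bound for the deviation of the empirical tail sum. -/
theorem measure_empTailSum_deviation_le [IsProbabilityMeasure P] (hK : 0 < K) (hN : 1 ≤ N)
    {f : Score 𝒳 K} (hf : Measurable f) (hc : ∀ k, Continuous (scoreCDF P f k)) (t D : ℝ) :
    (Measure.pi fun _ : Fin N => P.fst) {u | |D| ≤ |empTailSum u f t - tailSum P f t|}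
      ≤ ENNReal.ofReal (2 * (K / (2 * Real.sqrt N)) ^ 2 / ((K / (2 * Real.sqrt N)) ^ 2 + D ^ 2)) := by
  have hN' : (0 : ℝ) < N := by exact_mod_cast hN
  have hK' : (0 : ℝ) < K := by exact_mod_cast hK
  set a : ℝ := K / (2 * Real.sqrt N) with ha
  have ha0 : 0 < a := by positivity
  -- For D² ≤ a² the right side is at least one; otherwise Chebyshev's a²/D² is at most 2a²/(a² +
  -- D²). This form stays bounded at D = 0, so it can be integrated over D.
  by_cases hD : D ^ 2 ≤ a ^ 2
  · refine prob_le_one.trans ?_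
    rw [← ENNReal.ofReal_one]
    refine ENNReal.ofReal_le_ofReal ?_
    rw [le_div_iff₀ (by positivity)]
    linarith
  · push Not at hD
    have hD0 : 0 < |D| := by
      rw [abs_pos]; rintro rfl; nlinarith
    have h := meas_ge_le_variance_div_sq (memLp_empTailSum (P := P) (N := N) hf t) hD0
    rw [integral_empTailSum hN hf hc] at h
    refine h.trans (ENNReal.ofReal_le_ofReal ?_)
    rw [sq_abs]
    calc _ ≤ a ^ 2 / D ^ 2 := by
          gcongr; exact variance_empTailSum_le hN hf t
      _ ≤ 2 * a ^ 2 / (a ^ 2 + D ^ 2) := by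
          rw [div_le_div_iff₀ (by nlinarith [sq_nonneg a]) (by positivity)]
          nlinarith [sq_nonneg a, mul_le_mul_of_nonneg_left hD.le (sq_nonneg a)]

theorem lintegral_scoreLaw {f : Score 𝒳 K} (hf : Measurable f) {h : ℝ → ENNReal}
    (hh : Measurable h) :
    ∫⁻ t, h t ∂(scoreLaw P f) = ∑ k, ∫⁻ x, h (f x k) ∂P.fst := by
  rw [scoreLaw, lintegral_finsetSum_measure]
  exact Finset.sum_congr rfl fun k _ => lintegral_map hh (measurable_score_apply hf k)

/-- Layer cake: the integrand never exceeds 2, and where it exceeds s one has |G - β| ≤ a√(2/s), a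
band of mass at most 2a√(2/s). Integrating over s in (0, 2] gives 8a. -/
theorem lintegral_cauchy_tailSum_le [IsProbabilityMeasure P]
    {f : Score 𝒳 K} (hf : Measurable f) (hc : ∀ k, Continuous (scoreCDF P f k)) (β : ℝ)
    {a : ℝ} (ha : 0 < a) :
    ∫⁻ t, ENNReal.ofReal (2 * a ^ 2 / (a ^ 2 + (tailSum P f t - β) ^ 2)) ∂(scoreLaw P f)
      ≤ ENNReal.ofReal (8 * a) := by
  have hG := continuous_tailSum hc
  have hm : Measurable fun t => 2 * a ^ 2 / (a ^ 2 + (tailSum P f t - β) ^ 2) :=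
    measurable_const.div (measurable_const.add ((hG.measurable.sub measurable_const).pow_const 2))
  rw [lintegral_eq_lintegral_meas_lt _
    (Filter.Eventually.of_forall fun t => by positivity) hm.aemeasurable]
  have hpt : ∀ s ∈ Set.Ioi (0 : ℝ),
      scoreLaw P f {t | s < 2 * a ^ 2 / (a ^ 2 + (tailSum P f t - β) ^ 2)}
        ≤ (Set.Ioc (0 : ℝ) 2).indicator
          (fun s => ENNReal.ofReal (2 * Real.sqrt 2 * a * s ^ (-(1 / 2) : ℝ))) s := by
    intro s hs
    have hs0 : 0 < s := hs
    by_cases h2 : s ≤ 2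
    · rw [Set.indicator_of_mem (show s ∈ Set.Ioc (0 : ℝ) 2 from ⟨hs, h2⟩)]
      have : 2 * Real.sqrt 2 * a * s ^ (-(1 / 2) : ℝ) = 2 * (a * Real.sqrt (2 / s)) := by
        rw [Real.rpow_neg hs0.le, ← Real.sqrt_eq_rpow, Real.sqrt_div zero_le_two]
        ring
      rw [this]
      refine le_trans (measure_mono fun t ht => ?_) (scoreLaw_band_le hf hc β _)
      change s < _ at ht
      change |tailSum P f t - β| ≤ a * Real.sqrt (2 / s)
      rw [lt_div_iff₀ (by positivity)] at ht
      refine abs_le_of_sq_le_sq ?_ (by positivity)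
      rw [mul_pow, Real.sq_sqrt (by positivity), mul_div_assoc', le_div_iff₀ hs0]
      nlinarith [mul_pos hs0 (pow_pos ha 2)]
    · refine le_trans (le_of_eq ?_) (zero_le)
      have : {t | s < 2 * a ^ 2 / (a ^ 2 + (tailSum P f t - β) ^ 2)} = ∅ := by
        refine Set.eq_empty_of_forall_notMem fun t ht => ?_
        change s < _ at ht
        rw [lt_div_iff₀ (by positivity)] at ht
        push Not at h2
        nlinarith [sq_nonneg (tailSum P f t - β), pow_pos ha 2]
      rw [this, measure_empty]
  refine (setLIntegral_mono' measurableSet_Ioi hpt).trans ?_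
  rw [setLIntegral_indicator measurableSet_Ioc,
    Set.inter_eq_left.2 (show Set.Ioc (0 : ℝ) 2 ⊆ Set.Ioi 0 from fun s hs => hs.1)]
  have hint : IntervalIntegrable (fun s : ℝ => 2 * Real.sqrt 2 * a * s ^ (-(1 / 2) : ℝ))
      volume 0 2 :=
    (intervalIntegral.intervalIntegrable_rpow' (by norm_num)).const_mul _
  rw [← ofReal_integral_eq_lintegral_ofReal
    ((intervalIntegrable_iff_integrableOn_Ioc_of_le zero_le_two).1 hint)
    ((ae_restrict_iff' measurableSet_Ioc).2 (Filter.Eventually.of_forall fun s hs => by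
      have := hs.1
      change 0 ≤ 2 * Real.sqrt 2 * a * s ^ (-(1 / 2) : ℝ)
      positivity)),
    ← intervalIntegral.integral_of_le zero_le_two, intervalIntegral.integral_const_mul,
    integral_rpow (Or.inl (by norm_num))]
  refine ENNReal.ofReal_le_ofReal (le_of_eq ?_)
  have h1 : (-(1 / 2) : ℝ) + 1 = 1 / 2 := by norm_num
  rw [h1, Real.zero_rpow (by norm_num), ← Real.sqrt_eq_rpow]
  nlinarith [Real.mul_self_sqrt (zero_le_two : (0 : ℝ) ≤ 2)]

/-- Since G is antitone with G(`t₀`) = β, a disagreement at (x, k) places β between the empirical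
and the true tail at f_k(x). Exchanging the integrals freezes x, so the pointwise deviation bound
applies; the integral over x is then one over the summed law of the scores, with 8a = 4K/√N. -/
theorem lintegral_abs_risk_empConfSet_sub_le [IsProbabilityMeasure P] (hK : 0 < K) (hN : 1 ≤ N)
    {f : Score 𝒳 K} (hf : Measurable f) (hc : ∀ k, Continuous (scoreCDF P f k)) {β t₀ : ℝ}
    (ht₀ : tailSum P f t₀ = β) :
    ∫⁻ u : Fin N → 𝒳, ENNReal.ofReal
        |risk P (empConfSet u f β) - risk P (thresholdSet f (-t₀))| ∂(Measure.pi fun _ => P.fst)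
      ≤ ENNReal.ofReal (4 * (K / Real.sqrt N)) := by
  have hN' : (0 : ℝ) < N := by exact_mod_cast hN
  have hK' : (0 : ℝ) < K := by exact_mod_cast hK
  have hfk := fun k => measurable_score_apply hf k
  have hG := continuous_tailSum hc
  set a : ℝ := K / (2 * Real.sqrt N) with ha
  have ha0 : 0 < a := by positivity
  have hmis : ∀ k, MeasurableSet {q : (Fin N → 𝒳) × 𝒳 |
      ¬ (k ∈ empConfSet q.1 f β q.2 ↔ k ∈ thresholdSet f (-t₀) q.2)} := by
    intro k
    refine MeasurableSet.compl (MeasurableSet.iff (measurableSet_le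
      (measurable_empTailSum_uncurry ((hfk k).comp measurable_snd) fun i k' =>
        (hfk k').comp ((measurable_pi_apply i).comp measurable_fst)) measurable_const)
      (measurableSet_le measurable_const ((hfk k).comp measurable_snd)))
  have hmeas : Measurable fun t => ENNReal.ofReal (2 * a ^ 2 / (a ^ 2 + (tailSum P f t - β) ^ 2)) :=
    (measurable_const.div (measurable_const.add
      ((hG.measurable.sub measurable_const).pow_const 2))).ennreal_ofReal
  calc ∫⁻ u : Fin N → 𝒳, ENNReal.ofReal
        |risk P (empConfSet u f β) - risk P (thresholdSet f (-t₀))| ∂(Measure.pi fun _ => P.fst)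
      ≤ ∫⁻ u : Fin N → 𝒳, ∑ k, P.fst {x | ¬ (k ∈ empConfSet u f β x ↔
          k ∈ thresholdSet f (-t₀) x)} ∂(Measure.pi fun _ => P.fst) := by
        refine lintegral_mono fun u => ?_
        refine (ENNReal.ofReal_le_ofReal (abs_risk_sub_le (fun k => ?_) fun k => ?_)).trans ?_
        · exact measurableSet_le (measurable_empTailSum_uncurry (hfk k) fun i k' =>
            measurable_const) measurable_const
        · exact measurableSet_le measurable_const (hfk k)
        · rw [ENNReal.ofReal_sum_of_nonneg fun _ _ => measureReal_nonneg]
          exact Finset.sum_le_sum fun k _ => (ofReal_measureReal).le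
    _ = ∑ k, ∫⁻ u : Fin N → 𝒳, P.fst {x | ¬ (k ∈ empConfSet u f β x ↔
          k ∈ thresholdSet f (-t₀) x)} ∂(Measure.pi fun _ => P.fst) :=
        lintegral_finsetSum _ fun k _ => measurable_measure_prodMk_left (hmis k)
    _ = ∑ k, ∫⁻ x, (Measure.pi fun _ : Fin N => P.fst) {u | ¬ (k ∈ empConfSet u f β x ↔
          k ∈ thresholdSet f (-t₀) x)} ∂P.fst := by
        refine Finset.sum_congr rfl fun k _ => ?_
        have h1 := Measure.prod_apply (μ := Measure.pi fun _ : Fin N => P.fst) (ν := P.fst) (hmis k)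
        rw [Measure.prod_apply_symm (hmis k)] at h1
        exact h1.symm
    _ ≤ ∑ k, ∫⁻ x, ENNReal.ofReal (2 * a ^ 2 / (a ^ 2 + (tailSum P f (f x k) - β) ^ 2)) ∂P.fst := by
        refine Finset.sum_le_sum fun k _ => lintegral_mono fun x => ?_
        refine (measure_mono fun u hu => ?_).trans
          (measure_empTailSum_deviation_le hK hN hf hc (f x k) (tailSum P f (f x k) - β))
        have hanti := antitone_tailSum (P := P) hf
        have hu' : ¬ (empTailSum u f (f x k) ≤ β ↔ t₀ ≤ f x k) := by
          simpa [empConfSet, levelSet, thresholdSet] using hu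
        change |tailSum P f (f x k) - β| ≤ |empTailSum u f (f x k) - tailSum P f (f x k)|
        by_cases h : t₀ ≤ f x k
        · have h1 := hanti h
          have h2 : β < empTailSum u f (f x k) := by
            by_contra h3; exact hu' (by simp [h, not_lt.1 h3])
          rw [abs_of_nonpos (by linarith), abs_of_nonneg (by linarith)]
          linarith
        · have h1 := hanti (not_le.1 h).le
          have h2 : empTailSum u f (f x k) ≤ β := by
            by_contra h3; exact hu' (by simp [h, h3])
          rw [abs_of_nonneg (by linarith), abs_of_nonpos (by linarith)]
          linarith
    _ = ∫⁻ t, ENNReal.ofReal (2 * a ^ 2 / (a ^ 2 + (tailSum P f t - β) ^ 2)) ∂(scoreLaw P f) :=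
        (lintegral_scoreLaw hf hmeas).symm
    _ ≤ ENNReal.ofReal (8 * a) := lintegral_cauchy_tailSum_le hf hc β ha0
    _ = ENNReal.ofReal (4 * (K / Real.sqrt N)) := by
        congr 1; rw [ha]; field_simp; ring

end EmpiricalTail

/-! ### Lipschitz and integrability properties of the loss -/

section Loss

theorem continuous_of_convexOn_univ {φ : ℝ → ℝ} (hφ : ConvexOn ℝ Set.univ φ) : Continuous φ :=
  continuousOn_univ.1 (hφ.continuousOn isOpen_univ)

theorem labelSign_eq {K : ℕ} (y k : Fin K) : labelSign y k = if y = k then 1 else -1 := by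
  unfold labelSign; split_ifs <;> norm_num

theorem abs_labelSign {K : ℕ} (y k : Fin K) : |labelSign y k| = 1 := by
  rw [labelSign_eq]; split_ifs <;> simp

variable {𝒳 : Type*} {K : ℕ} {φ : ℝ → ℝ} {B L : ℝ}

theorem abs_scoreLoss_sub_le
    (hlip : ∀ x ∈ Set.Icc (-B) B, ∀ y ∈ Set.Icc (-B) B, |φ x - φ y| ≤ L * |x - y|)
    {f g : Score 𝒳 K} {z : 𝒳 × Fin K} (hf : ∀ k, |f z.1 k| ≤ B) (hg : ∀ k, |g z.1 k| ≤ B) :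
    |scoreLoss φ f z - scoreLoss φ g z| ≤ L * ∑ k, |f z.1 k - g z.1 k| := by
  have hmem : ∀ k, ∀ a : ℝ, |a| ≤ B → labelSign z.2 k * a ∈ Set.Icc (-B) B := fun k a ha => by
    rw [Set.mem_Icc, ← abs_le, abs_mul, abs_labelSign, one_mul]; exact ha
  rw [scoreLoss, scoreLoss, ← Finset.sum_sub_distrib, Finset.mul_sum]
  refine (Finset.abs_sum_le_sum_abs _ _).trans (Finset.sum_le_sum fun k _ => ?_)
  refine (hlip _ (hmem k _ (hf k)) _ (hmem k _ (hg k))).trans (le_of_eq ?_)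
  rw [← mul_sub, abs_mul, abs_labelSign, one_mul]

theorem abs_scoreLoss_le {M : ℝ} (hM : ∀ x ∈ Set.Icc (-B) B, |φ x| ≤ M)
    {f : Score 𝒳 K} {z : 𝒳 × Fin K} (hf : ∀ k, |f z.1 k| ≤ B) :
    |scoreLoss φ f z| ≤ K * M := by
  calc |scoreLoss φ f z| ≤ ∑ k, |φ (labelSign z.2 k * f z.1 k)| := Finset.abs_sum_le_sum_abs _ _
    _ ≤ ∑ _k : Fin K, M := Finset.sum_le_sum fun k _ => hM _ (by
        rw [Set.mem_Icc, ← abs_le, abs_mul, abs_labelSign, one_mul]; exact hf k)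
    _ = K * M := by simp

theorem exists_bound_Icc (hφ : Continuous φ) (B : ℝ) :
    ∃ M, 0 ≤ M ∧ ∀ x ∈ Set.Icc (-B) B, |φ x| ≤ M := by
  obtain ⟨M, hM⟩ := isCompact_Icc.exists_bound_of_continuousOn (s := Set.Icc (-B) B) hφ.continuousOn
  exact ⟨max M 0, le_max_right _ _, fun x hx => (hM x hx).trans (le_max_left _ _)⟩

variable [MeasurableSpace 𝒳] {P : Measure (𝒳 × Fin K)}

theorem ae_fst {p : 𝒳 → Prop} (h : ∀ᵐ x ∂P.fst, p x) : ∀ᵐ z ∂P, p z.1 :=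
  ae_of_ae_map measurable_fst.aemeasurable h

theorem measurable_scoreLoss_uncurry {Ω : Type*} [MeasurableSpace Ω] (hφ : Measurable φ)
    {f : Ω → Score 𝒳 K} {z : Ω → 𝒳 × Fin K} (hz : Measurable z)
    (hf : ∀ k, Measurable fun ω => f ω (z ω).1 k) :
    Measurable fun ω => scoreLoss φ (f ω) (z ω) :=
  Finset.measurable_sum _ fun k _ => hφ.comp
    (((Measurable.of_discrete (f := fun y => labelSign y k)).comp (measurable_snd.comp hz)).mul
      (hf k))

theorem measurable_scoreLoss (hφ : Measurable φ) {f : Score 𝒳 K} (hf : Measurable f) :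
    Measurable (scoreLoss φ f) :=
  measurable_scoreLoss_uncurry hφ measurable_id fun k =>
    (measurable_score_apply hf k).comp measurable_fst

theorem integrable_scoreLoss [IsFiniteMeasure P] (hφ : Continuous φ) {f : Score 𝒳 K}
    (hf : Measurable f) (hB : SupBounded P B f) : Integrable (scoreLoss φ f) P := by
  obtain ⟨M, -, hM⟩ := exists_bound_Icc hφ B
  refine Integrable.of_bound (measurable_scoreLoss hφ.measurable hf).aestronglyMeasurable (K * M) ?_
  filter_upwards [ae_fst hB] with z hz
  exact abs_scoreLoss_le hM hz

end Loss

/-! ### Conditional class probabilities -/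

section Disintegration

variable {𝒳 : Type*} [MeasurableSpace 𝒳] {K : ℕ} [NeZero K] {P : Measure (𝒳 × Fin K)}
  [IsProbabilityMeasure P]

theorem measurable_condProb : Measurable (condProb P) :=
  measurable_pi_lambda _ fun k =>
    (Kernel.measurable_coe P.condKernel (measurableSet_singleton k)).ennreal_toReal

theorem condProb_nonneg (x : 𝒳) (k : Fin K) : 0 ≤ condProb P x k := measureReal_nonneg

theorem condProb_le_one (x : 𝒳) (k : Fin K) : condProb P x k ≤ 1 := measureReal_le_one

theorem integral_ite_label {k : Fin K} {w₁ w₂ : 𝒳 → ℝ}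
    (hi : Integrable (fun z : 𝒳 × Fin K => if z.2 = k then w₁ z.1 else w₂ z.1) P) :
    ∫ z, (if z.2 = k then w₁ z.1 else w₂ z.1) ∂P
      = ∫ x, (condProb P x k * w₁ x + (1 - condProb P x k) * w₂ x) ∂P.fst := by
  rw [← Measure.integral_condKernel hi]
  refine integral_congr_ae (Filter.Eventually.of_forall fun x => ?_)
  have h : (fun y : Fin K => if y = k then w₁ x else w₂ x)
      = fun y => w₂ x + ({k} : Set (Fin K)).indicator (fun _ => w₁ x - w₂ x) y := by
    ext y
    by_cases hy : y = k <;> simp [hy]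
  change ∫ y, (if y = k then w₁ x else w₂ x) ∂(P.condKernel x) = _
  rw [h, integral_add (integrable_const _)
    ((integrable_const _).indicator (measurableSet_singleton k)),
    integral_indicator_const _ (measurableSet_singleton k)]
  simp only [integral_const, probReal_univ, smul_eq_mul, condProb]
  ring

end Disintegration

/-! ### Localizing the excess φ-risk -/

section Comparison

variable {𝒳 : Type*} [MeasurableSpace 𝒳] {K : ℕ} [NeZero K] {P : Measure (𝒳 × Fin K)}
  [IsProbabilityMeasure P] {φ : ℝ → ℝ} {B : ℝ} {fstar : Score 𝒳 K}

/-- The excess risk of a bounded score dominates the marginal excess risks accumulated on any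
measurable sets on which the minimizer stays bounded. -/
theorem sum_integral_indicator_marginalExcess_le (hφ : Continuous φ)
    (hmin : IsPhiRiskMinimizer P φ fstar) {f : Score 𝒳 K} (hf : Measurable f)
    (hB : SupBounded P B f) {E : Fin K → Set 𝒳} (hE : ∀ k, MeasurableSet (E k)) {T : ℝ}
    (hT : ∀ k, ∀ x ∈ E k, |fstar x k| ≤ T) :
    (∀ k, Integrable ((E k).indicator fun x => marginalExcess P φ fstar k (f x k) x) P.fst) ∧
    ∑ k, ∫ x, (E k).indicator (fun x => marginalExcess P φ fstar k (f x k) x) x ∂P.fst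
      ≤ phiRisk P φ f - phiRisk P φ fstar := by
  classical
  obtain ⟨M, hM0, hM⟩ := exists_bound_Icc hφ (max B T)
  have hfs := hmin.1
  -- Hybrid competitor: label k uses `fstar` on `E k` and `f` elsewhere. It is bounded, hence of
  -- finite risk, and R(f) - R(h) is exactly the sum of the localized marginal excesses, while
  -- minimality gives R(f*) ≤ R(h). Pointwise optimality of `fstar` is never needed.
  let h : Score 𝒳 K := fun x k => if x ∈ E k then fstar x k else f x k
  have hh : Measurable h := measurable_pi_lambda _ fun k =>
    Measurable.ite (hE k) (measurable_score_apply hfs k) (measurable_score_apply hf k)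
  have hhB : SupBounded P (max B T) h := by
    filter_upwards [hB] with x hx k
    by_cases hxk : x ∈ E k
    · simpa [h, hxk] using Or.inr (hT k x hxk)
    · simpa [h, hxk] using Or.inl (hx k)
  have hih := integrable_scoreLoss hφ hh hhB
  have hif := integrable_scoreLoss hφ hf hB
  have hle := hmin.2.2 h hh hih
  let w : Fin K → ℝ → 𝒳 → ℝ := fun k ε x =>
    (E k).indicator (fun x => φ (ε * f x k) - φ (ε * fstar x k)) x
  have hwm : ∀ k ε, Measurable (w k ε) := fun k ε =>
    ((hφ.measurable.comp (measurable_const.mul (measurable_score_apply hf k))).sub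
      (hφ.measurable.comp (measurable_const.mul (measurable_score_apply hfs k)))).indicator (hE k)
  have hwb : ∀ᵐ x ∂P.fst, ∀ k, ∀ ε : ℝ, |ε| = 1 → |w k ε x| ≤ 2 * M := by
    filter_upwards [hB] with x hx k ε hε
    by_cases hxk : x ∈ E k
    · have h1 : |φ (ε * f x k)| ≤ M := hM _ (by
        rw [Set.mem_Icc, ← abs_le, abs_mul, hε, one_mul]; exact (hx k).trans (le_max_left _ _))
      have h2 : |φ (ε * fstar x k)| ≤ M := hM _ (by
        rw [Set.mem_Icc, ← abs_le, abs_mul, hε, one_mul]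
        exact (hT k x hxk).trans (le_max_right _ _))
      simp only [w, Set.indicator_of_mem hxk]
      exact (abs_sub _ _).trans (by linarith)
    · simp only [w, Set.indicator_of_notMem hxk, abs_zero]; positivity
  have hwi : ∀ k, Integrable
      (fun z : 𝒳 × Fin K => if z.2 = k then w k 1 z.1 else w k (-1) z.1) P := by
    intro k
    refine Integrable.of_bound (Measurable.ite (measurable_snd (measurableSet_singleton k))
      ((hwm k 1).comp measurable_fst) ((hwm k (-1)).comp measurable_fst)).aestronglyMeasurable
      (2 * M) ?_
    filter_upwards [ae_fst hwb] with z hz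
    split_ifs
    · exact hz k 1 (by simp)
    · exact hz k (-1) (by simp)
  have hwi' : ∀ k ε, |ε| = 1 → Integrable (w k ε) P.fst := fun k ε hε =>
    Integrable.of_bound (hwm k ε).aestronglyMeasurable (2 * M)
      (hwb.mono fun x hx => hx k ε hε)
  have hind : ∀ k x, (E k).indicator (fun x => marginalExcess P φ fstar k (f x k) x) x
      = condProb P x k * w k 1 x + (1 - condProb P x k) * w k (-1) x := by
    intro k x
    by_cases hxk : x ∈ E k
    · simp [w, hxk, marginalExcess]
    · simp [w, hxk]
  constructor
  · intro k
    simp_rw [funext (hind k)]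
    have hp := (measurable_score_apply (measurable_condProb (P := P)) k)
    refine Integrable.add ((hwi' k 1 (by simp)).bdd_mul (c := 1) hp.aestronglyMeasurable
      (Filter.Eventually.of_forall fun x => ?_)) ((hwi' k (-1) (by simp)).bdd_mul (c := 1)
      (measurable_const.sub hp).aestronglyMeasurable (Filter.Eventually.of_forall fun x => ?_))
    · rw [Real.norm_eq_abs, abs_of_nonneg (condProb_nonneg x k)]; exact condProb_le_one x k
    · rw [Real.norm_eq_abs, abs_of_nonneg (by linarith [condProb_le_one (P := P) x k])]
      linarith [condProb_nonneg (P := P) x k]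
  · have hdiff : ∀ z, scoreLoss φ f z - scoreLoss φ h z
        = ∑ k, if z.2 = k then w k 1 z.1 else w k (-1) z.1 := by
      intro z
      rw [scoreLoss, scoreLoss, ← Finset.sum_sub_distrib]
      refine Finset.sum_congr rfl fun k _ => ?_
      rw [labelSign_eq]
      by_cases hxk : z.1 ∈ E k <;> by_cases hk : z.2 = k <;> simp [w, h, hxk, hk]
    have : ∑ k, ∫ x, (E k).indicator (fun x => marginalExcess P φ fstar k (f x k) x) x ∂P.fst
        = phiRisk P φ f - phiRisk P φ h := by
      rw [phiRisk, phiRisk, ← integral_sub hif hih]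
      simp_rw [hdiff]
      rw [integral_finsetSum _ fun k _ => hwi k]
      refine Finset.sum_congr rfl fun k _ => ?_
      rw [integral_ite_label (hwi k)]
      simp_rw [hind k]
    rw [this]
    linarith

end Comparison

/-! ### From excess φ-risk to excess classification risk -/

section Margin

variable {𝒳 : Type*} [MeasurableSpace 𝒳] {K : ℕ} [NeZero K] {P : Measure (𝒳 × Fin K)}
  [IsProbabilityMeasure P] {φ : ℝ → ℝ} {B β α s c₂ c₃ : ℝ} {fstar : Score 𝒳 K}

/-- Points of `E k` at distance at most t from the threshold are counted by the margin condition. On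
the others the marginal excess is at least t^s / c₃, and Markov's inequality applies. -/
theorem sum_measure_le_of_marginalExcess (hφ : Continuous φ) (hc₃ : 0 < c₃) (hs : 0 < s)
    (hmargin : ∀ k, MarginCondition P β α c₂ k) (hmin : IsPhiRiskMinimizer P φ fstar)
    {f : Score 𝒳 K} (hf : Measurable f) (hB : SupBounded P B f)
    {E : Fin K → Set 𝒳} (hE : ∀ k, MeasurableSet (E k))
    (hne : ∀ᵐ x ∂P.fst, ∀ k, condProb P x k ≠ tailInv P β)
    (hex : ∀ᵐ x ∂P.fst, ∀ k, x ∈ E k →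
      |condProb P x k - tailInv P β| ^ s ≤ c₃ * marginalExcess P φ fstar k (f x k) x)
    {t : ℝ} (ht : 0 < t) :
    ∑ k, P.fst.real (E k)
      ≤ K * (c₂ * t ^ α) + c₃ / t ^ s * (phiRisk P φ f - phiRisk P φ fstar) := by
  have hts : 0 < t ^ s := Real.rpow_pos_of_pos ht s
  -- The minimizer `fstar` is not assumed bounded, so the comparison is made on {|f*_k| ≤ T} and T
  -- is sent to infinity at the end.
  let ET : ℕ → Fin K → Set 𝒳 := fun T k => E k ∩ {x | |fstar x k| ≤ T}
  have hET : ∀ T k, MeasurableSet (ET T k) := fun T k =>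
    (hE k).inter (measurableSet_le (measurable_score_apply hmin.1 k).abs measurable_const)
  have hbound : ∀ T, ∑ k, P.fst.real (ET T k)
      ≤ K * (c₂ * t ^ α) + c₃ / t ^ s * (phiRisk P φ f - phiRisk P φ fstar) := by
    intro T
    obtain ⟨hint, hsum⟩ := sum_integral_indicator_marginalExcess_le hφ hmin hf hB (hET T)
      (T := T) fun k x hx => hx.2
    have hk : ∀ k, P.fst.real (ET T k) ≤ c₂ * t ^ α + c₃ / t ^ s *
        ∫ x, (ET T k).indicator (fun x => marginalExcess P φ fstar k (f x k) x) x ∂P.fst := by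
      intro k
      have hp := measurable_score_apply (measurable_condProb (P := P)) k
      have hd : Measurable fun x => |condProb P x k - tailInv P β| :=
        (hp.sub measurable_const).abs
      set near : Set 𝒳 := {x | 0 < |condProb P x k - tailInv P β| ∧
        |condProb P x k - tailInv P β| ≤ t} with hnear
      set far : Set 𝒳 := ET T k ∩ {x | t < |condProb P x k - tailInv P β|} with hfar
      have hfarm : MeasurableSet far := (hET T k).inter (measurableSet_lt measurable_const hd)
      -- The margin condition ignores points exactly at the threshold; `hne` makes them negligible.
      have h1 : P.fst.real (ET T k) ≤ P.fst.real near + P.fst.real far := by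
        refine le_trans ?_ (measureReal_union_le near far)
        rw [measureReal_def, measureReal_def]
        refine ENNReal.toReal_mono (measure_ne_top _ _) (measure_mono_ae ?_)
        filter_upwards [hne] with x hx hxE
        by_cases hlt : t < |condProb P x k - tailInv P β|
        · exact Or.inr ⟨hxE, hlt⟩
        · exact Or.inl ⟨abs_pos.2 (sub_ne_zero.2 (hx k)), not_lt.1 hlt⟩
      have h2 : P.fst.real far ≤ c₃ / t ^ s *
          ∫ x, (ET T k).indicator (fun x => marginalExcess P φ fstar k (f x k) x) x ∂P.fst := by
        rw [← integral_const_mul]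
        have h3 : P.fst.real far = ∫ x, far.indicator (fun _ => (1 : ℝ)) x ∂P.fst := by
          rw [integral_indicator_const _ hfarm]; simp
        rw [h3]
        refine integral_mono_ae ((integrable_const _).indicator hfarm) ((hint k).const_mul _) ?_
        filter_upwards [hex] with x hx
        change far.indicator (fun _ => (1 : ℝ)) x ≤ _
        by_cases hxE : x ∈ ET T k
        · have h4 := hx k hxE.1
          simp only [Set.indicator_of_mem hxE]
          rw [div_mul_eq_mul_div]
          refine Set.indicator_apply_le' (fun hxf => ?_) fun _ => ?_
          · rw [le_div_iff₀ hts, one_mul]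
            exact (Real.rpow_le_rpow ht.le (le_of_lt hxf.2) hs.le).trans h4
          · exact div_nonneg ((Real.rpow_nonneg (abs_nonneg _) _).trans h4) hts.le
        · have : x ∉ far := fun h => hxE h.1
          simp [hxE, this]
      linarith [hmargin k t ht]
    calc ∑ k, P.fst.real (ET T k) ≤ ∑ k, (c₂ * t ^ α + c₃ / t ^ s *
        ∫ x, (ET T k).indicator (fun x => marginalExcess P φ fstar k (f x k) x) x ∂P.fst) :=
          Finset.sum_le_sum fun k _ => hk k
      _ = K * (c₂ * t ^ α) + c₃ / t ^ s * ∑ k,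
        ∫ x, (ET T k).indicator (fun x => marginalExcess P φ fstar k (f x k) x) x ∂P.fst := by
          rw [Finset.sum_add_distrib, Finset.sum_const, Finset.card_univ, Fintype.card_fin,
            nsmul_eq_mul, ← Finset.mul_sum]
      _ ≤ _ := by gcongr
  have hlim : Filter.Tendsto (fun T => ∑ k, P.fst.real (ET T k)) Filter.atTop
      (nhds (∑ k, P.fst.real (E k))) := by
    refine tendsto_finsetSum _ fun k _ => ?_
    have hU : ⋃ T, ET T k = E k := by
      ext x
      simp only [ET, Set.mem_iUnion, Set.mem_inter_iff, Set.mem_ofPred_eq]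
      exact ⟨fun ⟨_, h, _⟩ => h, fun h => ⟨_, h, Nat.le_ceil _⟩⟩
    have hmono : Monotone fun T => ET T k := fun a b hab x hx =>
      ⟨hx.1, show |fstar x k| ≤ (b : ℝ) from le_trans hx.2 (Nat.cast_le.2 hab)⟩
    have := tendsto_measure_iUnion_atTop (μ := P.fst) hmono
    rw [hU] at this
    exact (ENNReal.tendsto_toReal (measure_ne_top _ _)).comp this
  exact le_of_tendsto' hlim hbound

theorem convexOn_marginalExcess (hφ : ConvexOn ℝ Set.univ φ) (k : Fin K) (x : 𝒳) :
    ConvexOn ℝ Set.univ fun u => marginalExcess P φ fstar k u x := by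
  have hneg : ConvexOn ℝ Set.univ fun u : ℝ => φ (-u) :=
    hφ.comp_linearMap (-LinearMap.id : ℝ →ₗ[ℝ] ℝ)
  have h1 := (hφ.add_const (-φ (fstar x k))).smul (condProb_nonneg (P := P) x k)
  have h2 := (hneg.add_const (-φ (-fstar x k))).smul (sub_nonneg.2 (condProb_le_one (P := P) x k))
  exact h1.add h2

/-- The marginal excess is convex in the score and vanishes at f*_k, so on the segment from f*_k to
u it is at most the larger of 0 and its value at u. A positive value rules out the first
alternative. -/
theorem marginalExcess_le_of_between (hφ : ConvexOn ℝ Set.univ φ) {k : Fin K} {x : 𝒳} {b u : ℝ}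
    (hpos : 0 < marginalExcess P φ fstar k b x) (hb : b ∈ segment ℝ (fstar x k) u) :
    marginalExcess P φ fstar k b x ≤ marginalExcess P φ fstar k u x := by
  have h := (convexOn_marginalExcess (P := P) (fstar := fstar) hφ k x).le_max_of_mem_segment
    (Set.mem_univ _) (Set.mem_univ _) hb
  have h0 : marginalExcess P φ fstar k (fstar x k) x = 0 := by simp [marginalExcess]
  rw [h0] at h
  exact (le_max_iff.1 h).resolve_left (not_le.2 hpos)

/-- The thresholds `t₀` and -δ* are unrelated, so calibration controls only one half of the
symmetric difference. Equality of the total masses controls the other half for free, whence the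
factor 2. -/
theorem sum_symmDiff_thresholdSet_le (hφ : ConvexOn ℝ Set.univ φ) (hc₃ : 0 < c₃) (hs : 0 < s)
    (hβ0 : 0 < β) (hβK : β < K)
    (hA1 : ∀ k, Continuous (scoreCDF P (condProb P) k))
    (hmargin : ∀ k, MarginCondition P β α c₂ k) (hmin : IsPhiRiskMinimizer P φ fstar)
    {δstar : ℝ} (hcal : ∀ᵐ x ∂P.fst, thresholdSet fstar δstar x = oracleSet P β x)
    (hzhang : ∀ᵐ x ∂P.fst, ∀ k, |condProb P x k - tailInv P β| ^ s
      ≤ c₃ * marginalExcess P φ fstar k (-δstar) x)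
    {f : Score 𝒳 K} (hf : Measurable f) (hB : SupBounded P B f)
    (hc : ∀ k, Continuous (scoreCDF P f k)) {t₀ : ℝ} (ht₀ : tailSum P f t₀ = β)
    {t : ℝ} (ht : 0 < t) :
    ∑ k, P.fst.real {x | ¬ (k ∈ thresholdSet f (-t₀) x ↔ k ∈ oracleSet P β x)}
      ≤ 2 * (K * (c₂ * t ^ α) + c₃ / t ^ s * (phiRisk P φ f - phiRisk P φ fstar)) := by
  have hfs := hmin.1
  have hp := measurable_condProb (P := P)
  let Γ : Fin K → Set 𝒳 := fun k => {x | t₀ ≤ f x k}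
  let Γs : Fin K → Set 𝒳 := fun k => {x | -δstar ≤ fstar x k}
  have hΓ : ∀ k, MeasurableSet (Γ k) := fun k =>
    measurableSet_le measurable_const (measurable_score_apply hf k)
  have hΓs : ∀ k, MeasurableSet (Γs k) := fun k =>
    measurableSet_le measurable_const (measurable_score_apply hfs k)
  have horacle : ∀ k, {x | k ∈ oracleSet P β x} =ᵐ[P.fst] Γs k := fun k => by
    filter_upwards [hcal] with x hx
    change (k ∈ oracleSet P β x) = (-δstar ≤ fstar x k)
    rw [← hx]; rfl
  have hmassΓ : ∑ k, P.fst.real (Γ k) = β := by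
    rw [← ht₀, tailSum_eq_sum_le hf hc]
  have hmassΓs : ∑ k, P.fst.real (Γs k) = β := by
    rw [← sum_measure_levelSet hp hA1 hβ0 hβK]
    exact Finset.sum_congr rfl fun k _ => (measureReal_congr (horacle k)).symm
  have hsplit : ∀ k, P.fst.real {x | ¬ (k ∈ thresholdSet f (-t₀) x ↔ k ∈ oracleSet P β x)}
      ≤ P.fst.real (Γ k \ Γs k) + P.fst.real (Γs k \ Γ k) := by
    intro k
    refine le_trans (le_of_eq (measureReal_congr ?_)) (measureReal_union_le _ _)
    filter_upwards [horacle k] with x hx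
    have hx' : (k ∈ oracleSet P β x) = (x ∈ Γs k) := hx
    change (¬ (k ∈ thresholdSet f (-t₀) x ↔ k ∈ oracleSet P β x)) = (x ∈ Γ k \ Γs k ∪ Γs k \ Γ k)
    have h1 : k ∈ thresholdSet f (-t₀) x ↔ x ∈ Γ k := by simp [thresholdSet, Γ]
    rw [hx', h1, Set.mem_union, Set.mem_sdiff, Set.mem_sdiff]
    exact propext (by tauto)
  have hbal : ∑ k, P.fst.real (Γ k \ Γs k) = ∑ k, P.fst.real (Γs k \ Γ k) := by
    have h1 : ∀ k, P.fst.real (Γ k \ Γs k) - P.fst.real (Γs k \ Γ k)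
        = P.fst.real (Γ k) - P.fst.real (Γs k) := by
      intro k
      have e1 := measureReal_sdiff_add_inter (μ := P.fst) (s := Γ k) (hΓs k)
      have e2 := measureReal_sdiff_add_inter (μ := P.fst) (s := Γs k) (hΓ k)
      rw [Set.inter_comm] at e2
      linarith
    rw [← sub_eq_zero, ← Finset.sum_sub_distrib, Finset.sum_congr rfl fun k _ => h1 k,
      Finset.sum_sub_distrib, hmassΓ, hmassΓs, sub_self]
  have hne : ∀ᵐ x ∂P.fst, ∀ k, condProb P x k ≠ tailInv P β :=
    ae_all_iff.2 fun k => measure_eq_zero_iff_ae_notMem.1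
      (measure_score_eq_zero hp (hA1 k) (tailInv P β))
  have hpos : ∀ᵐ x ∂P.fst, ∀ k, 0 < marginalExcess P φ fstar k (-δstar) x := by
    filter_upwards [hne, hzhang] with x h1 h2 k
    exact pos_of_mul_pos_right ((Real.rpow_pos_of_pos
      (abs_pos.2 (sub_ne_zero.2 (h1 k))) s).trans_le (h2 k)) hc₃.le
  have hsum : ∑ k, P.fst.real {x | ¬ (k ∈ thresholdSet f (-t₀) x ↔ k ∈ oracleSet P β x)}
      ≤ ∑ k, P.fst.real (Γ k \ Γs k) + ∑ k, P.fst.real (Γs k \ Γ k) := by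
    rw [← Finset.sum_add_distrib]
    exact Finset.sum_le_sum fun k _ => hsplit k
  have hφc := continuous_of_convexOn_univ hφ
  have hseg : ∀ {E : Fin K → Set 𝒳}, (∀ k, ∀ x ∈ E k, -δstar ∈ segment ℝ (fstar x k) (f x k)) →
      ∀ᵐ x ∂P.fst, ∀ k, x ∈ E k →
        |condProb P x k - tailInv P β| ^ s ≤ c₃ * marginalExcess P φ fstar k (f x k) x := by
    intro E hE
    filter_upwards [hpos, hzhang] with x h1 h2 k hx
    exact (h2 k).trans (mul_le_mul_of_nonneg_left
      (marginalExcess_le_of_between hφ (h1 k) (hE k x hx)) hc₃.le)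
  -- If -δ* ≤ `t₀`, points of Γ outside Γ* satisfy f* < -δ* ≤ `t₀` ≤ f; if `t₀` ≤ -δ*, points of Γ*
  -- outside Γ satisfy f < `t₀` ≤ -δ* ≤ f*.
  rcases le_total (-δstar) t₀ with hle | hle
  · have := sum_measure_le_of_marginalExcess hφc hc₃ hs hmargin hmin hf hB
      (fun k => (hΓ k).diff (hΓs k)) hne (hseg fun k x hx => by
        rw [segment_eq_Icc ((not_le.1 hx.2).le.trans (hle.trans hx.1))]
        exact ⟨(not_le.1 hx.2).le, hle.trans hx.1⟩) ht
    linarith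
  · have := sum_measure_le_of_marginalExcess hφc hc₃ hs hmargin hmin hf hB
      (fun k => (hΓs k).diff (hΓ k)) hne (hseg fun k x hx => by
        have h2 : f x k ≤ -δstar := (not_le.1 hx.2).le.trans hle
        rw [segment_symm, segment_eq_Icc (h2.trans hx.1)]
        exact ⟨h2, hx.1⟩) ht
    linarith

theorem abs_risk_thresholdSet_sub_oracle_le (hφ : ConvexOn ℝ Set.univ φ) (hc₃ : 0 < c₃)
    (hs : 0 < s) (hβ0 : 0 < β) (hβK : β < K)
    (hA1 : ∀ k, Continuous (scoreCDF P (condProb P) k))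
    (hmargin : ∀ k, MarginCondition P β α c₂ k) (hmin : IsPhiRiskMinimizer P φ fstar)
    {δstar : ℝ} (hcal : ∀ᵐ x ∂P.fst, thresholdSet fstar δstar x = oracleSet P β x)
    (hzhang : ∀ᵐ x ∂P.fst, ∀ k, |condProb P x k - tailInv P β| ^ s
      ≤ c₃ * marginalExcess P φ fstar k (-δstar) x)
    {f : Score 𝒳 K} (hf : Measurable f) (hB : SupBounded P B f)
    (hc : ∀ k, Continuous (scoreCDF P f k)) {t₀ : ℝ} (ht₀ : tailSum P f t₀ = β)
    {t : ℝ} (ht : 0 < t) :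
    |risk P (thresholdSet f (-t₀)) - risk P (oracleSet P β)|
      ≤ 2 * (K * (c₂ * t ^ α) + c₃ / t ^ s * (phiRisk P φ f - phiRisk P φ fstar)) :=
  (abs_risk_sub_le (fun k => measurableSet_le measurable_const (measurable_score_apply hf k))
    fun k => measurableSet_le ((continuous_tailSum hA1).measurable.comp
      (measurable_score_apply (measurable_condProb (P := P)) k)) measurable_const).trans
    (sum_symmDiff_thresholdSet_le hφ hc₃ hs hβ0 hβK hA1 hmargin hmin hcal hzhang hf hB hc ht₀ ht)

end Margin

/-! ### Strong convexity from the modulus of convexity -/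

section StrongConvexity

theorem scoreLoss_midpoint_le {𝒳 : Type*} {K : ℕ} {φ : ℝ → ℝ} (hφ : ConvexOn ℝ Set.univ φ) (f g : Score 𝒳 K)
    (z : 𝒳 × Fin K) :
    scoreLoss φ (fun x k => (f x k + g x k) / 2) z ≤ (scoreLoss φ f z + scoreLoss φ g z) / 2 := by
  rw [scoreLoss, scoreLoss, scoreLoss, ← Finset.sum_add_distrib, Finset.sum_div]
  refine Finset.sum_le_sum fun k _ => ?_
  have := hφ.2 (Set.mem_univ (labelSign z.2 k * f z.1 k)) (Set.mem_univ (labelSign z.2 k * g z.1 k))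
    (by norm_num : (0 : ℝ) ≤ 1 / 2) (by norm_num : (0 : ℝ) ≤ 1 / 2) (by norm_num)
  simp only [smul_eq_mul] at this
  calc _ = φ (1 / 2 * (labelSign z.2 k * f z.1 k) + 1 / 2 * (labelSign z.2 k * g z.1 k)) := by
        congr 1; ring
    _ ≤ _ := this
    _ = _ := by ring

variable {𝒳 : Type*} [MeasurableSpace 𝒳] {K : ℕ} {P : Measure (𝒳 × Fin K)}

/-- The squared `L²` distance `∑_k 𝔼[(f_k - g_k)²(X)]`. -/
noncomputable def sqDist (P : Measure (𝒳 × Fin K)) (f g : Score 𝒳 K) : ℝ :=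
  ∑ k, ∫ x, (f x k - g x k) ^ 2 ∂P.fst

theorem sqDist_nonneg (f g : Score 𝒳 K) : 0 ≤ sqDist P f g :=
  Finset.sum_nonneg fun _ _ => integral_nonneg fun _ => sq_nonneg _

theorem measurable_midpoint {f g : Score 𝒳 K} (hf : Measurable f) (hg : Measurable g) :
    Measurable (fun x k => (f x k + g x k) / 2 : Score 𝒳 K) :=
  measurable_pi_lambda _ fun k =>
    ((measurable_score_apply hf k).add (measurable_score_apply hg k)).div_const 2

theorem supBounded_midpoint {B : ℝ} {f g : Score 𝒳 K} (hf : SupBounded P B f)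
    (hg : SupBounded P B g) : SupBounded P B (fun x k => (f x k + g x k) / 2) := by
  filter_upwards [hf, hg] with x h1 h2 k
  have a := abs_le.1 (h1 k)
  have b := abs_le.1 (h2 k)
  exact abs_le.2 ⟨by linarith [a.1, b.1], by linarith [a.2, b.2]⟩

/-- The pair itself competes in the infimum at ε equal to the root of its squared distance. At
distance zero the modulus gives no information, and plain midpoint convexity is used. -/
theorem mul_sqDist_le_of_convexityModulus [IsFiniteMeasure P] {φ : ℝ → ℝ} {B c₁ : ℝ}
    (hφ : ConvexOn ℝ Set.univ φ)
    (hmod : ∀ ε : ℝ, 0 < ε → ((c₁ * ε ^ 2 : ℝ) : EReal) ≤ convexityModulus P φ B ε)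
    {f g : Score 𝒳 K} (hf : Measurable f) (hg : Measurable g) (hfB : SupBounded P B f)
    (hgB : SupBounded P B g) :
    c₁ * sqDist P f g ≤ (phiRisk P φ f + phiRisk P φ g) / 2
      - phiRisk P φ (fun x k => (f x k + g x k) / 2) := by
  rcases (sqDist_nonneg (P := P) f g).eq_or_lt' with h0 | hpos
  · have hφc := continuous_of_convexOn_univ hφ
    have hif := integrable_scoreLoss hφc hf hfB
    have hig := integrable_scoreLoss hφc hg hgB
    rw [h0, mul_zero, sub_nonneg, phiRisk, phiRisk, phiRisk, ← integral_add hif hig,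
      ← integral_div]
    exact integral_mono (integrable_scoreLoss hφc (measurable_midpoint hf hg)
      (supBounded_midpoint hfB hgB)) ((hif.add hig).div_const 2) (scoreLoss_midpoint_le hφ f g)
  · have h := (hmod (Real.sqrt (sqDist P f g)) (Real.sqrt_pos.2 hpos)).trans
      (sInf_le ⟨f, g, hf, hg, hfB, hgB, (Real.sq_sqrt hpos.le).le, rfl⟩)
    rw [Real.sq_sqrt hpos.le] at h
    exact EReal.coe_le_coe_iff.1 h

end StrongConvexity

/-! ### A Bernstein bound penalized by the variance -/

section ExponentialMoment

/-- For |u| ≤ 1, exp u ≤ 1 + u + u². The linear term is centered, the quadratic one contributes at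
most τ²w, and 1 + τ²w ≤ exp(τ²w). -/
theorem lintegral_exp_centered_le_one {Z : Type*} [MeasurableSpace Z] {μ : Measure Z}
    [IsProbabilityMeasure μ] {ξ : Z → ℝ} (hξ : Measurable ξ) {b w τ : ℝ}
    (hb : ∀ᵐ z ∂μ, |ξ z| ≤ b) (hw : ∫ z, ξ z ^ 2 ∂μ ≤ w) (hτ : 0 ≤ τ) (hτb : τ * (2 * b) ≤ 1) :
    ∫⁻ z, ENNReal.ofReal (Real.exp (τ * (∫ z, ξ z ∂μ - ξ z) - τ ^ 2 * w)) ∂μ ≤ 1 := by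
  have hξi : Integrable ξ μ := Integrable.of_bound hξ.aestronglyMeasurable b hb
  set e : ℝ := ∫ z, ξ z ∂μ with he
  have heb : |e| ≤ b := by
    have := norm_integral_le_of_norm_le_const (μ := μ) (f := ξ) (C := b) hb
    simpa using this
  have hci : Integrable (fun z => (e - ξ z) ^ 2) μ := by
    refine Integrable.of_bound ((measurable_const.sub hξ).pow_const 2).aestronglyMeasurable
      ((2 * b) ^ 2) ?_
    filter_upwards [hb] with z hz
    rw [Real.norm_eq_abs, abs_pow]
    have : |e - ξ z| ≤ 2 * b := (abs_sub _ _).trans (by linarith)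
    gcongr
  have hvar : ∫ z, (e - ξ z) ^ 2 ∂μ ≤ w := by
    have h1 := variance_le_expectation_sq (μ := μ) (X := ξ) hξ.aestronglyMeasurable
    rw [variance_eq_integral hξ.aemeasurable] at h1
    refine le_trans (le_of_eq ?_) (h1.trans hw)
    refine integral_congr_ae (Filter.Eventually.of_forall fun z => ?_)
    change (e - ξ z) ^ 2 = (ξ z - e) ^ 2
    ring
  have hsub : Integrable (fun z => e - ξ z) μ := (integrable_const _).sub hξi
  have hlin : Integrable (fun z => 1 + τ * (e - ξ z)) μ :=
    (integrable_const _).add (hsub.const_mul _)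
  calc ∫⁻ z, ENNReal.ofReal (Real.exp (τ * (e - ξ z) - τ ^ 2 * w)) ∂μ
      ≤ ∫⁻ z, ENNReal.ofReal ((1 + τ * (e - ξ z) + τ ^ 2 * (e - ξ z) ^ 2)
          * Real.exp (-(τ ^ 2 * w))) ∂μ := by
        refine lintegral_mono_ae ?_
        filter_upwards [hb] with z hz
        refine ENNReal.ofReal_le_ofReal ?_
        rw [sub_eq_add_neg, Real.exp_add]
        refine mul_le_mul_of_nonneg_right ?_ (Real.exp_pos _).le
        have h1 : |τ * (e - ξ z)| ≤ 1 := by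
          rw [abs_mul, abs_of_nonneg hτ]
          refine le_trans (mul_le_mul_of_nonneg_left ?_ hτ) hτb
          exact (abs_sub _ _).trans (by linarith)
        have h2 := (abs_le.1 (Real.abs_exp_sub_one_sub_id_le h1)).2
        nlinarith
    _ = ENNReal.ofReal (∫ z, (1 + τ * (e - ξ z) + τ ^ 2 * (e - ξ z) ^ 2)
          * Real.exp (-(τ ^ 2 * w)) ∂μ) := by
        rw [ofReal_integral_eq_lintegral_ofReal]
        · exact (hlin.add (hci.const_mul _)).mul_const _
        · refine Filter.Eventually.of_forall fun z => mul_nonneg ?_ (Real.exp_pos _).le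
          nlinarith [sq_nonneg (1 + τ * (e - ξ z)), sq_nonneg (τ * (e - ξ z))]
    _ ≤ 1 := by
        rw [integral_mul_const, integral_add hlin (hci.const_mul _), integral_const_mul,
          integral_add (integrable_const _) (hsub.const_mul _),
          integral_const_mul, integral_sub (integrable_const _) hξi]
        simp only [integral_const, probReal_univ, smul_eq_mul, one_mul, ← he, sub_self, mul_zero,
          add_zero]
        rw [ENNReal.ofReal_le_one, Real.exp_neg, ← div_eq_mul_inv, div_le_one (Real.exp_pos _)]
        have := Real.add_one_le_exp (τ ^ 2 * w)
        nlinarith [mul_le_mul_of_nonneg_left hvar (sq_nonneg τ)]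

variable {𝒳 : Type*} [MeasurableSpace 𝒳] {K : ℕ} {P : Measure (𝒳 × Fin K)}
  [IsProbabilityMeasure P] {φ : ℝ → ℝ} {B L : ℝ}

theorem integral_sq_scoreLoss_sub_le
    (hlip : ∀ x ∈ Set.Icc (-B) B, ∀ y ∈ Set.Icc (-B) B, |φ x - φ y| ≤ L * |x - y|)
    {f g : Score 𝒳 K} (hf : Measurable f) (hg : Measurable g)
    (hfB : SupBounded P B f) (hgB : SupBounded P B g) :
    ∫ z, (scoreLoss φ f z - scoreLoss φ g z) ^ 2 ∂P ≤ L ^ 2 * K * sqDist P f g := by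
  have hm : ∀ k, Measurable fun x => (f x k - g x k) ^ 2 := fun k =>
    ((measurable_score_apply hf k).sub (measurable_score_apply hg k)).pow_const 2
  have hi : ∀ k, Integrable (fun x => (f x k - g x k) ^ 2) P.fst := by
    intro k
    refine Integrable.of_bound (hm k).aestronglyMeasurable ((2 * B) ^ 2) ?_
    filter_upwards [hfB, hgB] with x h1 h2
    rw [Real.norm_eq_abs, abs_pow]
    have : |f x k - g x k| ≤ 2 * B := (abs_sub _ _).trans (by linarith [h1 k, h2 k])
    gcongr
  have hi' : ∀ k, Integrable (fun z : 𝒳 × Fin K => (f z.1 k - g z.1 k) ^ 2) P := fun k =>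
    (hi k).comp_measurable measurable_fst
  have he : ∀ k, ∫ z, (f z.1 k - g z.1 k) ^ 2 ∂P = ∫ x, (f x k - g x k) ^ 2 ∂P.fst := fun k =>
    (integral_map measurable_fst.aemeasurable (hm k).aestronglyMeasurable).symm
  calc ∫ z, (scoreLoss φ f z - scoreLoss φ g z) ^ 2 ∂P
      ≤ ∫ z, L ^ 2 * K * ∑ k, (f z.1 k - g z.1 k) ^ 2 ∂P := by
        refine integral_mono_of_nonneg (Filter.Eventually.of_forall fun z => sq_nonneg _)
          ((integrable_finsetSum _ fun k _ => hi' k).const_mul _) ?_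
        filter_upwards [ae_fst hfB, ae_fst hgB] with z h1 h2
        have h3 := abs_scoreLoss_sub_le hlip h1 h2
        have h4 := sq_sum_le_card_mul_sum_sq (s := Finset.univ) (f := fun k => |f z.1 k - g z.1 k|)
        simp only [sq_abs, Finset.card_univ, Fintype.card_fin] at h4
        calc (scoreLoss φ f z - scoreLoss φ g z) ^ 2
            = |scoreLoss φ f z - scoreLoss φ g z| ^ 2 := (sq_abs _).symm
          _ ≤ (L * ∑ k, |f z.1 k - g z.1 k|) ^ 2 := by gcongr
          _ = L ^ 2 * (∑ k, |f z.1 k - g z.1 k|) ^ 2 := by ring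
          _ ≤ L ^ 2 * (K * ∑ k, (f z.1 k - g z.1 k) ^ 2) := by gcongr
          _ = _ := by ring
    _ = L ^ 2 * K * sqDist P f g := by
        rw [integral_const_mul, integral_finsetSum _ fun k _ => hi' k]
        simp_rw [he]
        rfl

/-- The excess loss is bounded by 2KLB, and its second moment by L²K times the squared distance.
Once τL²K ≤ c, the distance penalty pays for the second-order term; this is the source of the fast
rate. -/
theorem lintegral_exp_excessLoss_le_one (hL : 0 ≤ L) (hφ : Continuous φ)
    (hlip : ∀ x ∈ Set.Icc (-B) B, ∀ y ∈ Set.Icc (-B) B, |φ x - φ y| ≤ L * |x - y|)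
    {f g : Score 𝒳 K} (hf : Measurable f) (hg : Measurable g)
    (hfB : SupBounded P B f) (hgB : SupBounded P B g) {c τ : ℝ} (hτ : 0 ≤ τ)
    (hτ1 : τ * (4 * K * L * B) ≤ 1) (hτ2 : τ * (L ^ 2 * K) ≤ c) :
    ∫⁻ z, ENNReal.ofReal (Real.exp (τ * (phiRisk P φ f - phiRisk P φ g
      - (scoreLoss φ f z - scoreLoss φ g z) - c * sqDist P f g))) ∂P ≤ 1 := by
  have hif := integrable_scoreLoss hφ hf hfB
  have hig := integrable_scoreLoss hφ hg hgB
  have h := lintegral_exp_centered_le_one (μ := P)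
    (ξ := fun z => scoreLoss φ f z - scoreLoss φ g z) (b := 2 * K * L * B)
    ((measurable_scoreLoss hφ.measurable hf).sub (measurable_scoreLoss hφ.measurable hg))
    (by
      filter_upwards [ae_fst hfB, ae_fst hgB] with z h1 h2
      refine (abs_scoreLoss_sub_le hlip h1 h2).trans ?_
      calc L * ∑ k, |f z.1 k - g z.1 k| ≤ L * ∑ _k : Fin K, 2 * B := by
            gcongr with k _
            exact (abs_sub _ _).trans (by linarith [h1 k, h2 k])
        _ = 2 * K * L * B := by simp; ring)
    (integral_sq_scoreLoss_sub_le hlip hf hg hfB hgB) hτ (by linarith)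
  refine le_trans (lintegral_mono fun z => ENNReal.ofReal_le_ofReal (Real.exp_le_exp.2 ?_)) h
  rw [integral_sub hif hig]
  have : τ * (τ * (L ^ 2 * K) * sqDist P f g) ≤ τ * (c * sqDist P f g) := by
    gcongr
    exact sqDist_nonneg f g
  simp only [phiRisk]
  linarith

end ExponentialMoment

/-! ### Independence of held-out points through resampling -/

section Resampling

variable {ι Z : Type*} [Fintype ι] [DecidableEq ι] [MeasurableSpace Z] {μ : Measure Z}
  [IsProbabilityMeasure μ]

/-- Redrawing one coordinate independently leaves a product law unchanged. This replaces
conditioning on the other coordinates. -/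
theorem measurePreserving_update (i : ι) :
    MeasurePreserving (fun q : (ι → Z) × Z => Function.update q.1 i q.2)
      ((Measure.pi fun _ => μ).prod μ) (Measure.pi fun _ => μ) := by
  have hm : Measurable fun q : (ι → Z) × Z => Function.update q.1 i q.2 := by
    refine measurable_pi_lambda _ fun j => ?_
    by_cases h : j = i
    · subst h; simpa using measurable_snd
    · simp only [Function.update_of_ne h]
      exact (measurable_pi_apply j).comp measurable_fst
  refine ⟨hm, (Measure.pi_eq fun s hs => ?_).symm⟩
  rw [Measure.map_apply hm (MeasurableSet.univ_pi hs)]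
  have : (fun q : (ι → Z) × Z => Function.update q.1 i q.2) ⁻¹' Set.univ.pi s
      = (Set.univ.pi (Function.update s i Set.univ)) ×ˢ s i := by
    ext q
    simp only [Set.mem_preimage, Set.mem_pi, Set.mem_univ, true_implies, Set.mem_prod]
    constructor
    · intro h
      refine ⟨fun j => ?_, by simpa using h i⟩
      by_cases hj : j = i
      · subst hj; simp
      · simpa [Function.update_of_ne hj] using h j
    · rintro ⟨h1, h2⟩ j
      by_cases hj : j = i
      · subst hj; simpa using h2
      · simpa [Function.update_of_ne hj] using h1 j
  rw [this, Measure.prod_prod, Measure.pi_pi, ← Finset.mul_prod_erase _ _ (Finset.mem_univ i),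
    ← Finset.mul_prod_erase Finset.univ (fun j => μ (s j)) (Finset.mem_univ i)]
  simp only [Function.update_self, measure_univ, one_mul]
  rw [mul_comm]
  congr 1
  exact Finset.prod_congr rfl fun j hj => by rw [Function.update_of_ne (Finset.ne_of_mem_erase hj)]

/-- `F d` depends only on coordinates outside `S`, so given those the factors are independent with
mean at most one. Redrawing one coordinate of `S` affects a single factor, which is integrated out;
induct on `S`. -/
theorem lintegral_prod_eval_le_one {F : (ι → Z) → Z → ENNReal}
    (hF : Measurable (Function.uncurry F)) (S : Finset ι)
    (hinv : ∀ i ∈ S, ∀ d z, F (Function.update d i z) = F d)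
    (h1 : ∀ᵐ d ∂(Measure.pi fun _ : ι => μ), ∫⁻ z, F d z ∂μ ≤ 1) :
    ∫⁻ d, ∏ i ∈ S, F d (d i) ∂(Measure.pi fun _ : ι => μ) ≤ 1 := by
  have hFi : ∀ i, Measurable fun d : ι → Z => F d (d i) := fun i =>
    hF.comp (measurable_id.prodMk (measurable_pi_apply i))
  induction S using Finset.induction_on with
  | empty => simp
  | insert a S ha ih =>
    have ih := ih fun i hi => hinv i (Finset.mem_insert_of_mem hi)
    refine le_trans ?_ ih
    have hmp := measurePreserving_update (μ := μ) a
    have hprod : Measurable fun d : ι → Z => ∏ i ∈ S, F d (d i) :=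
      Finset.measurable_prod _ fun i _ => hFi i
    rw [← hmp.lintegral_comp (Finset.measurable_prod _ fun i _ => hFi i)]
    have hpt : ∀ q : (ι → Z) × Z, (∏ i ∈ insert a S,
        F (Function.update q.1 a q.2) (Function.update q.1 a q.2 i))
          = (∏ i ∈ S, F q.1 (q.1 i)) * F q.1 q.2 := by
      intro q
      rw [Finset.prod_insert ha, hinv a (Finset.mem_insert_self a S), Function.update_self, mul_comm]
      congr 1
      refine Finset.prod_congr rfl fun i hi => ?_
      rw [Function.update_of_ne (ne_of_mem_of_not_mem hi ha)]
    simp_rw [hpt]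
    have hm : Measurable fun q : (ι → Z) × Z => (∏ i ∈ S, F q.1 (q.1 i)) * F q.1 q.2 :=
      (hprod.comp measurable_fst).mul hF
    rw [lintegral_prod _ hm.aemeasurable]
    refine lintegral_mono_ae ?_
    filter_upwards [h1] with d hd
    change ∫⁻ z, (∏ i ∈ S, F d (d i)) * F d z ∂μ ≤ _
    rw [lintegral_const_mul _ (show Measurable (F d) from hF.comp measurable_prodMk_left)]
    exact mul_le_of_le_one_right zero_le hd

/-- Transfers an almost sure property of a fresh point to the sample point `d i`, when the property
does not otherwise depend on coordinate `i`. -/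
theorem ae_eval_of_ae_ae {S : Set ((ι → Z) × Z)} (hS : MeasurableSet S) (i : ι)
    (hinv : ∀ d z z', (Function.update d i z', z) ∈ S ↔ (d, z) ∈ S)
    (h : ∀ᵐ d ∂(Measure.pi fun _ : ι => μ), ∀ᵐ z ∂μ, (d, z) ∈ S) :
    ∀ᵐ d ∂(Measure.pi fun _ : ι => μ), (d, d i) ∈ S := by
  have hmp := measurePreserving_update (μ := μ) i
  have hm : MeasurableSet {d : ι → Z | (d, d i) ∈ S} :=
    (measurable_id.prodMk (measurable_pi_apply i)) hS
  rw [← hmp.map_eq, ae_map_iff hmp.measurable.aemeasurable hm]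
  have h2 := (Measure.ae_prod_iff_ae_ae (p := fun q => q ∈ S) hS).2 h
  filter_upwards [h2] with q hq
  rw [Function.update_self]
  exact (hinv _ _ _).2 hq

end Resampling

/-! ### Stability of risks and distances under small changes of score -/

section Perturbation

variable {𝒳 : Type*} [MeasurableSpace 𝒳] {K : ℕ} {P : Measure (𝒳 × Fin K)}
  [IsProbabilityMeasure P] {φ : ℝ → ℝ} {B L η : ℝ}

theorem abs_scoreLoss_sub_le_of_close {𝒳 : Type*} {K : ℕ} {φ : ℝ → ℝ} {B L η : ℝ} (hL : 0 ≤ L)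
    (hlip : ∀ x ∈ Set.Icc (-B) B, ∀ y ∈ Set.Icc (-B) B, |φ x - φ y| ≤ L * |x - y|)
    {f g : Score 𝒳 K} {z : 𝒳 × Fin K} (hf : ∀ k, |f z.1 k| ≤ B) (hg : ∀ k, |g z.1 k| ≤ B)
    (hfg : ∀ k, |f z.1 k - g z.1 k| ≤ η) :
    |scoreLoss φ f z - scoreLoss φ g z| ≤ L * (K * η) := by
  refine (abs_scoreLoss_sub_le hlip hf hg).trans (mul_le_mul_of_nonneg_left ?_ hL)
  calc ∑ k, |f z.1 k - g z.1 k| ≤ ∑ _k : Fin K, η := Finset.sum_le_sum fun k _ => hfg k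
    _ = K * η := by simp

theorem abs_phiRisk_sub_le_of_close (hL : 0 ≤ L) (hφ : Continuous φ)
    (hlip : ∀ x ∈ Set.Icc (-B) B, ∀ y ∈ Set.Icc (-B) B, |φ x - φ y| ≤ L * |x - y|)
    {f g : Score 𝒳 K} (hf : Measurable f) (hg : Measurable g)
    (hfB : SupBounded P B f) (hgB : SupBounded P B g)
    (hfg : ∀ᵐ x ∂P.fst, ∀ k, |f x k - g x k| ≤ η) :
    |phiRisk P φ f - phiRisk P φ g| ≤ L * (K * η) := by
  rw [phiRisk, phiRisk, ← integral_sub (integrable_scoreLoss hφ hf hfB)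
    (integrable_scoreLoss hφ hg hgB)]
  have := norm_integral_le_of_norm_le_const (μ := P)
    (f := fun z => scoreLoss φ f z - scoreLoss φ g z) (C := L * (K * η)) (by
      filter_upwards [ae_fst hfB, ae_fst hgB, ae_fst hfg] with z h1 h2 h3
      exact abs_scoreLoss_sub_le_of_close hL hlip h1 h2 h3)
  simpa using this

theorem integrable_sq_sub {f g : Score 𝒳 K} (hf : Measurable f) (hg : Measurable g)
    (hfB : SupBounded P B f) (hgB : SupBounded P B g) (k : Fin K) :
    Integrable (fun x => (f x k - g x k) ^ 2) P.fst := by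
  refine Integrable.of_bound (((measurable_score_apply hf k).sub
    (measurable_score_apply hg k)).pow_const 2).aestronglyMeasurable ((2 * B) ^ 2) ?_
  filter_upwards [hfB, hgB] with x h1 h2
  rw [Real.norm_eq_abs, abs_pow]
  have : |f x k - g x k| ≤ 2 * B := (abs_sub _ _).trans (by linarith [h1 k, h2 k])
  gcongr

theorem sqDist_le_of_close (hη : 0 ≤ η) {f g f' g' : Score 𝒳 K}
    (hf : Measurable f) (hg : Measurable g) (hf' : Measurable f') (hg' : Measurable g')
    (hfB : SupBounded P B f) (hgB : SupBounded P B g) (hfB' : SupBounded P B f')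
    (hgB' : SupBounded P B g') (hff : ∀ᵐ x ∂P.fst, ∀ k, |f x k - f' x k| ≤ η)
    (hgg : ∀ᵐ x ∂P.fst, ∀ k, |g x k - g' x k| ≤ η) :
    sqDist P f' g' ≤ sqDist P f g + 8 * K * η * B := by
  have h : ∀ k, ∫ x, (f' x k - g' x k) ^ 2 ∂P.fst
      ≤ ∫ x, (f x k - g x k) ^ 2 ∂P.fst + 8 * η * B := by
    intro k
    have hi := integrable_sq_sub hf hg hfB hgB k
    have : ∫ x, ((f x k - g x k) ^ 2 + 8 * η * B) ∂P.fst
        = ∫ x, (f x k - g x k) ^ 2 ∂P.fst + 8 * η * B := by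
      rw [integral_add hi (integrable_const _)]; simp
    rw [← this]
    refine integral_mono_ae (integrable_sq_sub hf' hg' hfB' hgB' k) (hi.add (integrable_const _)) ?_
    filter_upwards [hfB, hgB, hfB', hgB', hff, hgg] with x a b a' b' ha hb
    have e : (f' x k - g' x k) ^ 2 - (f x k - g x k) ^ 2
        = ((f' x k - f x k) - (g' x k - g x k)) * ((f' x k - g' x k) + (f x k - g x k)) := by ring
    have h1 : |(f' x k - f x k) - (g' x k - g x k)| ≤ 2 * η := by
      refine (abs_sub _ _).trans ?_
      rw [abs_sub_comm (f' x k), abs_sub_comm (g' x k)]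
      linarith [ha k, hb k]
    have h2 : |(f' x k - g' x k) + (f x k - g x k)| ≤ 4 * B := by
      refine (abs_add_le _ _).trans ?_
      have := abs_sub (f' x k) (g' x k)
      have := abs_sub (f x k) (g x k)
      linarith [a k, b k, a' k, b' k]
    have h3 : (f' x k - g' x k) ^ 2 - (f x k - g x k) ^ 2 ≤ 2 * η * (4 * B) := by
      rw [e]
      refine (le_abs_self _).trans ?_
      rw [abs_mul]
      exact mul_le_mul h1 h2 (abs_nonneg _) (by positivity)
    change _ ≤ (f x k - g x k) ^ 2 + 8 * η * B
    linarith
  calc sqDist P f' g' ≤ ∑ k, (∫ x, (f x k - g x k) ^ 2 ∂P.fst + 8 * η * B) :=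
        Finset.sum_le_sum fun k _ => h k
    _ = _ := by
        rw [Finset.sum_add_distrib, Finset.sum_const, Finset.card_univ, Fintype.card_fin,
          nsmul_eq_mul, sqDist]
        ring

end Perturbation

/-! ### Scores trained outside a block -/

section Folds

theorem trainMeasure_update {𝒳 : Type*} [MeasurableSpace 𝒳] {K n V : ℕ} {fold : Fin n → Fin V}
    {v : Fin V} {i : Fin n} (hi : i ∈ block fold v) (d : Fin n → 𝒳 × Fin K) (z : 𝒳 × Fin K) :
    trainMeasure fold (Function.update d i z) v = trainMeasure fold d v := by
  unfold trainMeasure empiricalMeasure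
  congr 1
  refine Finset.sum_congr rfl fun j hj => ?_
  rw [Function.update_of_ne]
  rintro rfl
  exact Finset.mem_compl.1 hj hi

variable {𝒳 : Type*} [MeasurableSpace 𝒳] {K n V M : ℕ} {fold : Fin n → Fin V}
  {A : Fin M → ScoreAlgorithm 𝒳 K} {B : ℝ}

theorem foldScore_apply (d : Fin n → 𝒳 × Fin K) (m : Fin M → ℝ) (v : Fin V) (x : 𝒳) (k : Fin K) :
    foldScore A fold d m v x k = ∑ j, m j * A j (trainMeasure fold d v) x k := rfl

theorem foldScore_update {v : Fin V} {i : Fin n} (hi : i ∈ block fold v)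
    (d : Fin n → 𝒳 × Fin K) (z : 𝒳 × Fin K) (m : Fin M → ℝ) :
    foldScore A fold (Function.update d i z) m v = foldScore A fold d m v := by
  unfold foldScore
  rw [trainMeasure_update hi]

theorem measurable_foldScore_uncurry
    (hA : ∀ j v, Measurable fun q : (Fin n → 𝒳 × Fin K) × 𝒳 =>
      A j (trainMeasure fold q.1 v) q.2)
    {Ω : Type*} [MeasurableSpace Ω] {d : Ω → Fin n → 𝒳 × Fin K} {m : Ω → Fin M → ℝ} {x : Ω → 𝒳}
    (hd : Measurable d) (hm : Measurable m) (hx : Measurable x) (v : Fin V) (k : Fin K) :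
    Measurable fun ω => foldScore A fold (d ω) (m ω) v (x ω) k := by
  simp only [foldScore_apply]
  refine Finset.measurable_sum _ fun j _ => ((measurable_pi_apply j).comp hm).mul ?_
  have h := (hA j v).comp (hd.prodMk hx)
  exact measurable_pi_iff.1 h k

theorem measurable_foldScore
    (hA : ∀ j v, Measurable fun q : (Fin n → 𝒳 × Fin K) × 𝒳 =>
      A j (trainMeasure fold q.1 v) q.2) (d : Fin n → 𝒳 × Fin K) (m : Fin M → ℝ) (v : Fin V) :
    Measurable (foldScore A fold d m v) :=
  measurable_pi_lambda _ fun k =>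
    measurable_foldScore_uncurry hA measurable_const measurable_const measurable_id v k

theorem abs_foldScore_sub_le {d : Fin n → 𝒳 × Fin K} {v : Fin V} {x : 𝒳} {k : Fin K}
    (hB : ∀ j, |A j (trainMeasure fold d v) x k| ≤ B) (m m' : Fin M → ℝ) :
    |foldScore A fold d m v x k - foldScore A fold d m' v x k| ≤ (∑ j, |m j - m' j|) * B := by
  rw [foldScore_apply, foldScore_apply, ← Finset.sum_sub_distrib, Finset.sum_mul]
  refine (Finset.abs_sum_le_sum_abs _ _).trans (Finset.sum_le_sum fun j _ => ?_)
  rw [← sub_mul, abs_mul]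
  exact mul_le_mul_of_nonneg_left (hB j) (abs_nonneg _)

/-- Total weight at most one is allowed, rather than exactly one, because weights rounded down to a
grid may leave the simplex. -/
theorem abs_foldScore_le {d : Fin n → 𝒳 × Fin K} {v : Fin V} {x : 𝒳} {k : Fin K} (hB0 : 0 ≤ B)
    (hB : ∀ j, |A j (trainMeasure fold d v) x k| ≤ B) {m : Fin M → ℝ} (hm : ∀ j, 0 ≤ m j)
    (hm1 : ∑ j, m j ≤ 1) : |foldScore A fold d m v x k| ≤ B := by
  have h := abs_foldScore_sub_le hB m 0
  have h0 : foldScore A fold d 0 v x k = 0 := by simp [foldScore_apply]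
  rw [h0, sub_zero] at h
  refine h.trans ?_
  simp only [Pi.zero_apply, sub_zero, fun j => abs_of_nonneg (hm j)]
  exact mul_le_of_le_one_left hB0 hm1

theorem foldScore_midpoint (d : Fin n → 𝒳 × Fin K) (m m' : Fin M → ℝ) (v : Fin V) :
    foldScore A fold d (fun j => (m j + m' j) / 2) v
      = fun x k => (foldScore A fold d m v x k + foldScore A fold d m' v x k) / 2 := by
  ext x k
  rw [foldScore_apply, foldScore_apply, foldScore_apply, ← Finset.sum_add_distrib, Finset.sum_div]
  exact Finset.sum_congr rfl fun j _ => by ring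

variable {P : Measure (𝒳 × Fin K)}

/-- The null set in `SupBounded` may vary with the weights. The vertices of the simplex are finitely
many and give one null set for all weights, including those outside the simplex. -/
theorem ae_abs_algorithm_le
    (hB : ∀ᵐ d ∂(Measure.pi fun _ : Fin n => P), ∀ m ∈ stdSimplex ℝ (Fin M), ∀ v,
      SupBounded P B (foldScore A fold d m v)) :
    ∀ᵐ d ∂(Measure.pi fun _ : Fin n => P), ∀ v, ∀ᵐ x ∂P.fst, ∀ k j,
      |A j (trainMeasure fold d v) x k| ≤ B := by
  filter_upwards [hB] with d hd v
  have h : ∀ j, ∀ᵐ x ∂P.fst, ∀ k, |A j (trainMeasure fold d v) x k| ≤ B := by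
    intro j
    filter_upwards [hd _ (single_mem_stdSimplex ℝ j) v] with x hx k
    have := hx k
    rw [foldScore_apply, Finset.sum_eq_single j] at this
    · simpa using this
    · intro i _ hij; simp [hij]
    · simp
  filter_upwards [ae_all_iff.2 h] with x hx k j using hx j k

variable [IsProbabilityMeasure P]

/-- The bound holds only for almost every x, yet empirical risks evaluate scores at sample points;
each such point is independent of the training measure of its own fold. -/
theorem ae_abs_algorithm_eval_le
    (hA : ∀ j v, Measurable fun q : (Fin n → 𝒳 × Fin K) × 𝒳 =>
      A j (trainMeasure fold q.1 v) q.2)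
    (hB : ∀ᵐ d ∂(Measure.pi fun _ : Fin n => P), ∀ v, ∀ᵐ x ∂P.fst, ∀ k j,
      |A j (trainMeasure fold d v) x k| ≤ B) :
    ∀ᵐ d ∂(Measure.pi fun _ : Fin n => P), ∀ i k j,
      |A j (trainMeasure fold d (fold i)) (d i).1 k| ≤ B := by
  refine ae_all_iff.2 fun i => ae_all_iff.2 fun k => ae_all_iff.2 fun j => ?_
  refine ae_eval_of_ae_ae
    (S := {q : (Fin n → 𝒳 × Fin K) × (𝒳 × Fin K) |
      |A j (trainMeasure fold q.1 (fold i)) q.2.1 k| ≤ B}) ?_ i ?_ ?_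
  · exact measurableSet_le ((measurable_pi_apply k).comp ((hA j (fold i)).comp
      (measurable_fst.prodMk (measurable_fst.comp measurable_snd)))).abs measurable_const
  · intro d z z'
    simp only [Set.mem_ofPred_eq]
    rw [trainMeasure_update]
    simp [block]
  · filter_upwards [hB] with d hd
    filter_upwards [ae_fst (hd (fold i))] with z hz using hz k j

theorem measurable_phiRisk_foldScore {φ : ℝ → ℝ} (hφ : Measurable φ)
    (hA : ∀ j v, Measurable fun q : (Fin n → 𝒳 × Fin K) × 𝒳 =>
      A j (trainMeasure fold q.1 v) q.2)
    {m : (Fin n → 𝒳 × Fin K) → Fin M → ℝ} (hm : Measurable m) (v : Fin V) :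
    Measurable fun d => phiRisk P φ (foldScore A fold d (m d) v) := by
  have h : Measurable fun q : (Fin n → 𝒳 × Fin K) × (𝒳 × Fin K) =>
      scoreLoss φ (foldScore A fold q.1 (m q.1) v) q.2 :=
    measurable_scoreLoss_uncurry hφ measurable_snd fun k =>
      measurable_foldScore_uncurry hA measurable_fst (hm.comp measurable_fst)
        (measurable_fst.comp measurable_snd) v k
  exact (h.stronglyMeasurable.integral_prod_right' (ν := P)).measurable

theorem measurable_sqDist_foldScore
    (hA : ∀ j v, Measurable fun q : (Fin n → 𝒳 × Fin K) × 𝒳 =>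
      A j (trainMeasure fold q.1 v) q.2) (m m' : Fin M → ℝ) (v : Fin V) :
    Measurable fun d => sqDist P (foldScore A fold d m v) (foldScore A fold d m' v) := by
  refine Finset.measurable_sum _ fun k _ => ?_
  have h : Measurable fun q : (Fin n → 𝒳 × Fin K) × 𝒳 =>
      (foldScore A fold q.1 m v q.2 k - foldScore A fold q.1 m' v q.2 k) ^ 2 :=
    ((measurable_foldScore_uncurry hA measurable_fst measurable_const measurable_snd v k).sub
      (measurable_foldScore_uncurry hA measurable_fst measurable_const
        measurable_snd v k)).pow_const 2
  exact (h.stronglyMeasurable.integral_prod_right' (ν := P.fst)).measurable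

end Folds

/-! ### Discretizing the simplex of weights -/

section Grid

variable {M n : ℕ}

/-- The weights with coordinates `q_j / n`. -/
noncomputable def gridWeights (q : Fin M → Fin (n + 1)) : Fin M → ℝ := fun j => (q j : ℝ) / n

open Classical in
/-- The grid points of total weight at most one. -/
noncomputable def subGrid (M n : ℕ) : Finset (Fin M → Fin (n + 1)) :=
  Finset.univ.filter fun q => ∑ j, gridWeights q j ≤ 1

theorem gridWeights_nonneg (q : Fin M → Fin (n + 1)) (j : Fin M) : 0 ≤ gridWeights q j := by
  unfold gridWeights; positivity

theorem sum_gridWeights_le_one {q : Fin M → Fin (n + 1)} (hq : q ∈ subGrid M n) :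
    ∑ j, gridWeights q j ≤ 1 := by
  classical
  exact (Finset.mem_filter.1 hq).2

theorem card_subGrid_le : (subGrid M n).card ≤ (n + 1) ^ M := by
  classical
  refine (Finset.card_filter_le _ _).trans (le_of_eq ?_)
  simp

theorem exists_mem_subGrid (hn : 0 < n) {m : Fin M → ℝ} (hm : m ∈ stdSimplex ℝ (Fin M)) :
    ∃ q ∈ subGrid M n, ∑ j, |m j - gridWeights q j| ≤ M / n := by
  classical
  have hn' : (0 : ℝ) < n := by exact_mod_cast hn
  have hm1 : ∀ j, m j ≤ 1 := fun j => by
    rw [← hm.2]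
    exact Finset.single_le_sum (fun i _ => hm.1 i) (Finset.mem_univ j)
  -- Rounding down keeps the total weight at most one and costs at most 1/n per coordinate.
  let q : Fin M → Fin (n + 1) := fun j => ⟨⌊n * m j⌋₊, Nat.lt_succ_of_le (by
    refine Nat.floor_le_of_le ?_
    exact mul_le_of_le_one_right hn'.le (hm1 j))⟩
  have hle : ∀ j, gridWeights q j ≤ m j := fun j => by
    simp only [gridWeights, q]
    rw [div_le_iff₀ hn', mul_comm (m j)]
    exact Nat.floor_le (mul_nonneg hn'.le (hm.1 j))
  have hge : ∀ j, m j - gridWeights q j ≤ 1 / n := fun j => by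
    simp only [gridWeights, q]
    rw [sub_le_iff_le_add, ← add_div, le_div_iff₀ hn', mul_comm, add_comm]
    exact (Nat.lt_floor_add_one _).le
  refine ⟨q, Finset.mem_filter.2 ⟨Finset.mem_univ _, ?_⟩, ?_⟩
  · rw [← hm.2]
    exact Finset.sum_le_sum fun j _ => hle j
  · calc ∑ j, |m j - gridWeights q j| ≤ ∑ _j : Fin M, 1 / (n : ℝ) :=
          Finset.sum_le_sum fun j _ => by rw [abs_of_nonneg (sub_nonneg.2 (hle j))]; exact hge j
      _ = M / n := by simp [div_eq_mul_inv]

end Grid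

/-! ### Pathwise oracle inequality for the empirical minimizer -/

section OracleInequality

variable {𝒳 : Type*} [MeasurableSpace 𝒳] {K n V M : ℕ} {fold : Fin n → Fin V}
  {A : Fin M → ScoreAlgorithm 𝒳 K} {φ : ℝ → ℝ} {B L c τ : ℝ}

/-- The deviation on the block `B_v` between the oracle and the empirical excess risks of two
convex combinations, penalized by their squared distance. -/
noncomputable def foldDeviation (P : Measure (𝒳 × Fin K)) (φ : ℝ → ℝ) (c : ℝ)
    (A : Fin M → ScoreAlgorithm 𝒳 K) (fold : Fin n → Fin V) (v : Fin V) (m m' : Fin M → ℝ)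
    (d : Fin n → 𝒳 × Fin K) : ℝ :=
  phiRisk P φ (foldScore A fold d m v) - phiRisk P φ (foldScore A fold d m' v)
    - 1 / ((block fold v).card : ℝ) * ∑ i ∈ block fold v,
      (scoreLoss φ (foldScore A fold d m v) (d i) - scoreLoss φ (foldScore A fold d m' v) (d i))
    - c * sqDist P (foldScore A fold d m v) (foldScore A fold d m' v)

variable {P : Measure (𝒳 × Fin K)} [IsProbabilityMeasure P]

theorem measurable_foldDeviation (hφ : Measurable φ)
    (hA : ∀ j v, Measurable fun q : (Fin n → 𝒳 × Fin K) × 𝒳 =>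
      A j (trainMeasure fold q.1 v) q.2) (v : Fin V) (m m' : Fin M → ℝ) :
    Measurable (foldDeviation P φ c A fold v m m') := by
  have hl : ∀ (m : Fin M → ℝ) (i : Fin n), Measurable fun d : Fin n → 𝒳 × Fin K =>
      scoreLoss φ (foldScore A fold d m v) (d i) := fun m i =>
    measurable_scoreLoss_uncurry hφ (measurable_pi_apply i) fun k =>
      measurable_foldScore_uncurry hA measurable_id measurable_const
        (measurable_fst.comp (measurable_pi_apply i)) v k
  unfold foldDeviation
  refine Measurable.sub (((measurable_phiRisk_foldScore hφ hA measurable_const v).sub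
    (measurable_phiRisk_foldScore hφ hA measurable_const v)).sub
    (measurable_const.mul (Finset.measurable_sum _ fun i _ => (hl m i).sub (hl m' i)))) ?_
  exact measurable_const.mul (measurable_sqDist_foldScore hA m m' v)

/-- Multiplying by the block size turns the block average into a sum, so the exponential factors
over held-out points, each factor having mean at most one given the training data. -/
theorem lintegral_exp_foldDeviation_le_one (hB0 : 0 ≤ B) (hL : 0 ≤ L) (hφ : Continuous φ)
    (hlip : ∀ x ∈ Set.Icc (-B) B, ∀ y ∈ Set.Icc (-B) B, |φ x - φ y| ≤ L * |x - y|)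
    (hA : ∀ j v, Measurable fun q : (Fin n → 𝒳 × Fin K) × 𝒳 =>
      A j (trainMeasure fold q.1 v) q.2)
    (hB : ∀ᵐ d ∂(Measure.pi fun _ : Fin n => P), ∀ v, ∀ᵐ x ∂P.fst, ∀ k j,
      |A j (trainMeasure fold d v) x k| ≤ B)
    (hτ : 0 ≤ τ) (hτ1 : τ * (4 * K * L * B) ≤ 1) (hτ2 : τ * (L ^ 2 * K) ≤ c)
    {v : Fin V} (hv : 0 < (block fold v).card) {m m' : Fin M → ℝ}
    (hm : ∀ j, 0 ≤ m j) (hm1 : ∑ j, m j ≤ 1) (hm' : ∀ j, 0 ≤ m' j) (hm1' : ∑ j, m' j ≤ 1) :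
    ∫⁻ d, ENNReal.ofReal (Real.exp (τ * (block fold v).card * foldDeviation P φ c A fold v m m' d))
      ∂(Measure.pi fun _ : Fin n => P) ≤ 1 := by
  let F : (Fin n → 𝒳 × Fin K) → 𝒳 × Fin K → ENNReal := fun d z =>
    ENNReal.ofReal (Real.exp (τ * (phiRisk P φ (foldScore A fold d m v)
      - phiRisk P φ (foldScore A fold d m' v)
      - (scoreLoss φ (foldScore A fold d m v) z - scoreLoss φ (foldScore A fold d m' v) z)
      - c * sqDist P (foldScore A fold d m v) (foldScore A fold d m' v))))
  have hl : ∀ m : Fin M → ℝ, Measurable fun q : (Fin n → 𝒳 × Fin K) × (𝒳 × Fin K) =>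
      scoreLoss φ (foldScore A fold q.1 m v) q.2 := fun m =>
    measurable_scoreLoss_uncurry hφ.measurable measurable_snd fun k =>
      measurable_foldScore_uncurry hA measurable_fst measurable_const
        (measurable_fst.comp measurable_snd) v k
  have hr : ∀ m : Fin M → ℝ, Measurable fun d => phiRisk P φ (foldScore A fold d m v) := fun m =>
    measurable_phiRisk_foldScore hφ.measurable hA measurable_const v
  have hF : Measurable (Function.uncurry F) :=
    (Real.measurable_exp.comp (measurable_const.mul
      (((((hr m).sub (hr m')).comp measurable_fst).sub ((hl m).sub (hl m'))).sub
        (measurable_const.mul ((measurable_sqDist_foldScore hA m m' v).comp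
          measurable_fst))))).ennreal_ofReal
  have hinv : ∀ i ∈ block fold v, ∀ d z, F (Function.update d i z) = F d := fun i hi d z => by
    simp only [F, foldScore_update hi]
  have h1 : ∀ᵐ d ∂(Measure.pi fun _ : Fin n => P), ∫⁻ z, F d z ∂P ≤ 1 := by
    filter_upwards [hB] with d hd
    refine lintegral_exp_excessLoss_le_one hL hφ hlip (measurable_foldScore hA d m v)
      (measurable_foldScore hA d m' v) ?_ ?_ hτ hτ1 hτ2
    · filter_upwards [hd v] with x hx k using abs_foldScore_le hB0 (hx k) hm hm1
    · filter_upwards [hd v] with x hx k using abs_foldScore_le hB0 (hx k) hm' hm1'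
  refine le_trans (le_of_eq (lintegral_congr fun d => ?_))
    (lintegral_prod_eval_le_one hF (block fold v) hinv h1)
  have hv' : ((block fold v).card : ℝ) ≠ 0 := by positivity
  rw [← ENNReal.ofReal_prod_of_nonneg fun i _ => (Real.exp_pos _).le, ← Real.exp_sum,
    ← Finset.mul_sum, Finset.sum_sub_distrib, Finset.sum_sub_distrib, Finset.sum_const,
    Finset.sum_const, foldDeviation, nsmul_eq_mul, nsmul_eq_mul]
  congr 2
  field_simp

/-- A union bound in expectation: u + 1 - log N ≤ exp(u)/N, and one exponential is at most the sum.
The right side does not involve `i`, which may thus be random; when the exponential moments are at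
most one and the index set has at most N elements, its mean is at most log N. -/
theorem mul_le_sum_exp_add {ι : Type*} {s : Finset ι} {W : ι → ℝ} {l : ℝ} {i : ι} (hi : i ∈ s)
    {N : ℝ} (hN : 0 < N) :
    l * W i ≤ N⁻¹ * ∑ j ∈ s, Real.exp (l * W j) + (Real.log N - 1) := by
  have h1 := Real.add_one_le_exp (l * W i - Real.log N)
  rw [Real.exp_sub, Real.exp_log hN] at h1
  have h2 : Real.exp (l * W i) ≤ ∑ j ∈ s, Real.exp (l * W j) :=
    Finset.single_le_sum (f := fun j => Real.exp (l * W j)) (fun _ _ => (Real.exp_pos _).le) hi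
  have h3 : Real.exp (l * W i) / N ≤ N⁻¹ * ∑ j ∈ s, Real.exp (l * W j) := by
    rw [div_eq_inv_mul]
    exact mul_le_mul_of_nonneg_left h2 (by positivity)
  linarith

/-- The excess oracle risk of the empirical minimizer is controlled by the fold deviations at
grid approximations of the two minimizers. -/
theorem cvOracleRisk_sub_le (hn : 0 < n) (hV : 0 < V) (hB0 : 0 ≤ B) (hL : 0 ≤ L) (hc : 0 ≤ c)
    (hφ : ConvexOn ℝ Set.univ φ)
    (hlip : ∀ x ∈ Set.Icc (-B) B, ∀ y ∈ Set.Icc (-B) B, |φ x - φ y| ≤ L * |x - y|)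
    (hmod : ∀ ε : ℝ, 0 < ε → ((c * ε ^ 2 : ℝ) : EReal) ≤ convexityModulus P φ B ε)
    (hA : ∀ j v, Measurable fun q : (Fin n → 𝒳 × Fin K) × 𝒳 =>
      A j (trainMeasure fold q.1 v) q.2)
    (hblock : ∀ v, 0 < (block fold v).card)
    {d : Fin n → 𝒳 × Fin K}
    (hB : ∀ v, ∀ᵐ x ∂P.fst, ∀ k j, |A j (trainMeasure fold d v) x k| ≤ B)
    (hBd : ∀ i k j, |A j (trainMeasure fold d (fold i)) (d i).1 k| ≤ B)
    {m m' : Fin M → ℝ} (hm : IsConvArgmin (cvEmpRisk φ A fold d) m)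
    (hm' : IsConvArgmin (cvOracleRisk P φ A fold d) m') :
    ∃ q ∈ subGrid M n, ∃ q' ∈ subGrid M n,
      cvOracleRisk P φ A fold d m - cvOracleRisk P φ A fold d m'
        ≤ 2 * (1 / (V : ℝ) * ∑ v, foldDeviation P φ c A fold v (gridWeights q) (gridWeights q') d)
          + (8 * L * B + 16 * c * B ^ 2) * (K * M / n) := by
  obtain ⟨q, hq, hqd⟩ := exists_mem_subGrid hn hm.1
  obtain ⟨q', hq', hqd'⟩ := exists_mem_subGrid hn hm'.1
  refine ⟨q, hq, q', hq', ?_⟩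
  have hφc := continuous_of_convexOn_univ hφ
  have hV' : (0 : ℝ) < V := by exact_mod_cast hV
  set g := gridWeights q with hg
  set g' := gridWeights q' with hg'
  let f : (Fin M → ℝ) → Fin V → Score 𝒳 K := fun m v => foldScore A fold d m v
  have hfm : ∀ m v, Measurable (f m v) := fun m v => measurable_foldScore hA d m v
  have hfB : ∀ {m : Fin M → ℝ}, (∀ j, 0 ≤ m j) → ∑ j, m j ≤ 1 → ∀ v, SupBounded P B (f m v) :=
    fun h0 h1 v => by
      filter_upwards [hB v] with x hx k using abs_foldScore_le hB0 (hx k) h0 h1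
  have bm := hfB hm.1.1 hm.1.2.le
  have bm' := hfB hm'.1.1 hm'.1.2.le
  have bg := hfB (gridWeights_nonneg q) (sum_gridWeights_le_one hq)
  have bg' := hfB (gridWeights_nonneg q') (sum_gridWeights_le_one hq')
  set η : ℝ := M / n * B with hη
  have hη0 : 0 ≤ η := by positivity
  have hclose : ∀ {a b : Fin M → ℝ}, ∑ j, |a j - b j| ≤ M / n → ∀ v, ∀ᵐ x ∂P.fst, ∀ k,
      |f a v x k - f b v x k| ≤ η := fun h v => by
    filter_upwards [hB v] with x hx k
    exact (abs_foldScore_sub_le (hx k) _ _).trans (mul_le_mul_of_nonneg_right h hB0)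
  have hdev : ∀ {a b : Fin M → ℝ}, (∀ j, 0 ≤ a j) → ∑ j, a j ≤ 1 → (∀ j, 0 ≤ b j) →
      ∑ j, b j ≤ 1 → ∑ j, |a j - b j| ≤ M / n → ∀ v,
      |1 / ((block fold v).card : ℝ) * ∑ i ∈ block fold v,
        (scoreLoss φ (f a v) (d i) - scoreLoss φ (f b v) (d i))| ≤ L * (K * η) := by
    intro a b ha ha1 hb hb1 hab v
    have hv : (0 : ℝ) < (block fold v).card := by exact_mod_cast hblock v
    rw [abs_mul, abs_of_nonneg (by positivity), one_div_mul_eq_div, div_le_iff₀ hv]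
    refine (Finset.abs_sum_le_sum_abs _ _).trans ?_
    rw [mul_comm, ← nsmul_eq_mul, ← Finset.sum_const]
    refine Finset.sum_le_sum fun i hi => ?_
    have hfi : fold i = v := by simpa [block] using hi
    have hBi : ∀ k j, |A j (trainMeasure fold d v) (d i).1 k| ≤ B := by
      rw [← hfi]; exact hBd i
    exact abs_scoreLoss_sub_le_of_close hL hlip
      (fun k => abs_foldScore_le hB0 (hBi k) ha ha1)
      (fun k => abs_foldScore_le hB0 (hBi k) hb hb1)
      (fun k => (abs_foldScore_sub_le (hBi k) _ _).trans (mul_le_mul_of_nonneg_right hab hB0))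
  -- Passing to the grid moves two φ-risks and two block averages by at most LKη each, which
  -- explains the 4, and the squared distance by at most 8KηB.
  have hfold : ∀ v, phiRisk P φ (f m v) - phiRisk P φ (f m' v)
      - 1 / ((block fold v).card : ℝ) * ∑ i ∈ block fold v,
        (scoreLoss φ (f m v) (d i) - scoreLoss φ (f m' v) (d i))
      ≤ foldDeviation P φ c A fold v g g' d + c * sqDist P (f m v) (f m' v)
        + (4 * L * (K * η) + c * (8 * K * η * B)) := by
    intro v
    have h1 := (abs_le.1 (abs_phiRisk_sub_le_of_close hL hφc hlip (hfm m v) (hfm g v)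
      (bm v) (bg v) (hclose hqd v))).2
    have h2 := (abs_le.1 (abs_phiRisk_sub_le_of_close hL hφc hlip (hfm m' v) (hfm g' v)
      (bm' v) (bg' v) (hclose hqd' v))).1
    have h3 := (abs_le.1 (hdev hm.1.1 hm.1.2.le (gridWeights_nonneg q)
      (sum_gridWeights_le_one hq) hqd v)).1
    have h4 := (abs_le.1 (hdev hm'.1.1 hm'.1.2.le (gridWeights_nonneg q')
      (sum_gridWeights_le_one hq') hqd' v)).2
    have h5 := mul_le_mul_of_nonneg_left (sqDist_le_of_close hη0 (hfm m v) (hfm m' v) (hfm g v)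
      (hfm g' v) (bm v) (bm' v) (bg v) (bg' v) (hclose hqd v) (hclose hqd' v)) hc
    rw [Finset.sum_sub_distrib, mul_sub] at h3 h4
    have h6 : foldDeviation P φ c A fold v g g' d = phiRisk P φ (f g v) - phiRisk P φ (f g' v)
      - 1 / ((block fold v).card : ℝ) * ∑ i ∈ block fold v,
        (scoreLoss φ (f g v) (d i) - scoreLoss φ (f g' v) (d i))
      - c * sqDist P (f g v) (f g' v) := rfl
    rw [h6, Finset.sum_sub_distrib, Finset.sum_sub_distrib, mul_sub, mul_sub]
    linarith
  -- strong convexity at the oracle minimizer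
  have hmid : (fun j => (m j + m' j) / 2) ∈ stdSimplex ℝ (Fin M) := by
    refine ⟨fun j => by linarith [hm.1.1 j, hm'.1.1 j], ?_⟩
    rw [← Finset.sum_div, Finset.sum_add_distrib, hm.1.2, hm'.1.2]; norm_num
  -- The midpoint is admissible, so its oracle risk is at least that of `m'`. Strong convexity then
  -- bounds the mean penalty by half the excess; absorbing that half produces the factor 2 in the
  -- conclusion.
  have hsc : c * (1 / (V : ℝ) * ∑ v, sqDist P (f m v) (f m' v))
      ≤ (cvOracleRisk P φ A fold d m - cvOracleRisk P φ A fold d m') / 2 := by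
    have h1 : ∀ v, c * sqDist P (f m v) (f m' v)
        ≤ (phiRisk P φ (f m v) + phiRisk P φ (f m' v)) / 2
          - phiRisk P φ (f (fun j => (m j + m' j) / 2) v) := fun v => by
      have := mul_sqDist_le_of_convexityModulus hφ hmod (hfm m v) (hfm m' v) (bm v) (bm' v)
      simp only [f, foldScore_midpoint]
      exact this
    have h2 := mul_le_mul_of_nonneg_left (Finset.sum_le_sum fun v (_ : v ∈ Finset.univ) => h1 v)
      (by positivity : 0 ≤ 1 / (V : ℝ))
    rw [Finset.sum_sub_distrib, ← Finset.sum_div, Finset.sum_add_distrib, ← Finset.mul_sum] at h2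
    have h3 := hm'.2 _ hmid
    simp only [cvOracleRisk] at h3 ⊢
    simp only [f] at h2 ⊢
    linarith
  have hemp := hm.2 m' hm'.1
  have hsum := mul_le_mul_of_nonneg_left (Finset.sum_le_sum fun v (_ : v ∈ Finset.univ) => hfold v)
    (by positivity : 0 ≤ 1 / (V : ℝ))
  simp only [Finset.sum_sub_distrib, Finset.sum_add_distrib, mul_sub, mul_add, Finset.sum_const,
    Finset.card_univ, Fintype.card_fin, nsmul_eq_mul, ← Finset.mul_sum] at hsum
  have e1 : 1 / (V : ℝ) * ((V : ℝ) * (4 * L * (K * η))) = 4 * L * (K * η) := by field_simp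
  have e2 : 1 / (V : ℝ) * ((V : ℝ) * (c * (8 * K * η * B))) = c * (8 * K * η * B) := by field_simp
  rw [e1, e2] at hsum
  have e3 : (8 * L * B + 16 * c * B ^ 2) * (K * M / n : ℝ)
      = 2 * (4 * L * (K * η) + c * (8 * K * η * B)) := by
    rw [hη]; ring
  rw [e3]
  simp only [cvEmpRisk] at hemp
  simp only [cvOracleRisk] at hsc ⊢
  simp only [f] at hsum hsc
  linarith

end OracleInequality

/-! ### The aggregation bound in expectation -/

section ExpectedOracleInequality

variable {𝒳 : Type*} [MeasurableSpace 𝒳] {K n V M : ℕ} {fold : Fin n → Fin V}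
  {A : Fin M → ScoreAlgorithm 𝒳 K} {φ : ℝ → ℝ} {B L c τ : ℝ}
  {P : Measure (𝒳 × Fin K)} [IsProbabilityMeasure P]

theorem abs_one_div_mul_sum_le (hV : 0 < V) {a : Fin V → ℝ} {b : ℝ} (h : ∀ v, |a v| ≤ b) :
    |1 / (V : ℝ) * ∑ v, a v| ≤ b := by
  have hV' : (0 : ℝ) < V := by exact_mod_cast hV
  rw [abs_mul, abs_of_nonneg (by positivity), one_div_mul_eq_div, div_le_iff₀ hV']
  refine (Finset.abs_sum_le_sum_abs _ _).trans ((Finset.sum_le_sum fun v _ => h v).trans ?_)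
  simp [mul_comm]

theorem abs_phiRisk_le {b : ℝ} (hM : ∀ x ∈ Set.Icc (-B) B, |φ x| ≤ b) {f : Score 𝒳 K}
    (hB : SupBounded P B f) : |phiRisk P φ f| ≤ K * b := by
  have := norm_integral_le_of_norm_le_const (μ := P) (f := scoreLoss φ f) (C := K * b) (by
    filter_upwards [ae_fst hB] with z hz
    exact abs_scoreLoss_le hM hz)
  simpa [phiRisk] using this

theorem integrable_cvOracleRisk (hV : 0 < V) (hφ : Continuous φ)
    (hA : ∀ j v, Measurable fun q : (Fin n → 𝒳 × Fin K) × 𝒳 =>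
      A j (trainMeasure fold q.1 v) q.2)
    (hB : ∀ᵐ d ∂(Measure.pi fun _ : Fin n => P), ∀ m ∈ stdSimplex ℝ (Fin M), ∀ v,
      SupBounded P B (foldScore A fold d m v))
    {m : (Fin n → 𝒳 × Fin K) → Fin M → ℝ} (hm : Measurable m)
    (hms : ∀ᵐ d ∂(Measure.pi fun _ : Fin n => P), m d ∈ stdSimplex ℝ (Fin M)) :
    Integrable (fun d => cvOracleRisk P φ A fold d (m d)) (Measure.pi fun _ : Fin n => P) := by
  obtain ⟨b, -, hb⟩ := exists_bound_Icc hφ B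
  have hmeas : Measurable fun d => cvOracleRisk P φ A fold d (m d) :=
    measurable_const.mul (Finset.measurable_sum _ fun v _ =>
      measurable_phiRisk_foldScore hφ.measurable hA hm v)
  refine Integrable.of_bound hmeas.aestronglyMeasurable (K * b) ?_
  filter_upwards [hB, hms] with d hd hmd
  exact abs_one_div_mul_sum_le hV fun v => abs_phiRisk_le hb (hd _ hmd v)

/-- The soft maximum over pairs of grid points is applied in each fold separately and then averaged,
so dependence between folds plays no role. -/
theorem integral_cvOracleRisk_sub_le (hn : 0 < n) (hV : 0 < V) (hB0 : 0 ≤ B) (hL : 0 ≤ L)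
    (hc : 0 ≤ c) (hφ : ConvexOn ℝ Set.univ φ)
    (hlip : ∀ x ∈ Set.Icc (-B) B, ∀ y ∈ Set.Icc (-B) B, |φ x - φ y| ≤ L * |x - y|)
    (hmod : ∀ ε : ℝ, 0 < ε → ((c * ε ^ 2 : ℝ) : EReal) ≤ convexityModulus P φ B ε)
    (hA : ∀ j v, Measurable fun q : (Fin n → 𝒳 × Fin K) × 𝒳 =>
      A j (trainMeasure fold q.1 v) q.2)
    (hB : ∀ᵐ d ∂(Measure.pi fun _ : Fin n => P), ∀ m ∈ stdSimplex ℝ (Fin M), ∀ v,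
      SupBounded P B (foldScore A fold d m v))
    (hblock : ∀ v, 0 < (block fold v).card)
    (hτ : 0 < τ) (hτ1 : τ * (4 * K * L * B) ≤ 1) (hτ2 : τ * (L ^ 2 * K) ≤ c)
    {mhat mtilde : (Fin n → 𝒳 × Fin K) → Fin M → ℝ}
    (hmhat : Measurable mhat) (hmtilde : Measurable mtilde)
    (hhat : ∀ᵐ d ∂(Measure.pi fun _ : Fin n => P), IsConvArgmin (cvEmpRisk φ A fold d) (mhat d))
    (htilde : ∀ᵐ d ∂(Measure.pi fun _ : Fin n => P),
      IsConvArgmin (cvOracleRisk P φ A fold d) (mtilde d)) :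
    ∫ d, (cvOracleRisk P φ A fold d (mhat d) - cvOracleRisk P φ A fold d (mtilde d))
        ∂(Measure.pi fun _ : Fin n => P)
      ≤ 2 * (1 / (V : ℝ) * ∑ v, 1 / (τ * (block fold v).card) *
          Real.log ((((n + 1) ^ M) ^ 2 : ℕ) : ℝ))
        + (8 * L * B + 16 * c * B ^ 2) * (K * M / n) := by
  set π := Measure.pi fun _ : Fin n => P with hπ
  have hφc := continuous_of_convexOn_univ hφ
  -- Q bounds the number of pairs of grid points, (n+1)^M for each of the two minimizers.
  set Q : ℝ := ((((n + 1) ^ M) ^ 2 : ℕ) : ℝ) with hQ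
  have hQ0 : 0 < Q := by rw [hQ]; positivity
  let G := subGrid M n ×ˢ subGrid M n
  have hGcard : (G.card : ℝ) ≤ Q := by
    rw [hQ, Finset.card_product, pow_two]
    exact_mod_cast Nat.mul_le_mul card_subGrid_le card_subGrid_le
  have hB1 := ae_abs_algorithm_le hB
  have hB2 := ae_abs_algorithm_eval_le hA hB1
  let W : Fin V → (Fin M → Fin (n + 1)) × (Fin M → Fin (n + 1)) → (Fin n → 𝒳 × Fin K) → ℝ :=
    fun v q d => foldDeviation P φ c A fold v (gridWeights q.1) (gridWeights q.2) d
  let e : Fin V → (Fin M → Fin (n + 1)) × (Fin M → Fin (n + 1)) → (Fin n → 𝒳 × Fin K) → ℝ :=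
    fun v q d => Real.exp (τ * (block fold v).card * W v q d)
  have hem : ∀ v q, Measurable (e v q) := fun v q =>
    Real.measurable_exp.comp (measurable_const.mul
      (measurable_foldDeviation hφc.measurable hA v _ _))
  have hlint : ∀ v, ∀ q ∈ G, ∫⁻ d, ENNReal.ofReal (e v q d) ∂π ≤ 1 := by
    intro v q hq
    obtain ⟨h1, h2⟩ := Finset.mem_product.1 hq
    exact lintegral_exp_foldDeviation_le_one hB0 hL hφc hlip hA hB1 hτ.le hτ1 hτ2 (hblock v)
      (gridWeights_nonneg _) (sum_gridWeights_le_one h1) (gridWeights_nonneg _)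
      (sum_gridWeights_le_one h2)
  have hei : ∀ v, ∀ q ∈ G, Integrable (e v q) π := by
    intro v q hq
    refine ⟨(hem v q).aestronglyMeasurable, ?_⟩
    rw [hasFiniteIntegral_iff_ofReal (Filter.Eventually.of_forall fun d => (Real.exp_pos _).le)]
    exact (hlint v q hq).trans_lt ENNReal.one_lt_top
  have he1 : ∀ v, ∀ q ∈ G, ∫ d, e v q d ∂π ≤ 1 := by
    intro v q hq
    rw [← ENNReal.ofReal_le_one, ofReal_integral_eq_lintegral_ofReal (hei v q hq)
      (Filter.Eventually.of_forall fun d => (Real.exp_pos _).le)]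
    exact hlint v q hq
  let b : Fin V → ℝ := fun v => 1 / (τ * (block fold v).card)
  have hb0 : ∀ v, 0 ≤ b v := fun v => by positivity
  have hSi : ∀ v, Integrable (fun d => b v * (Q⁻¹ * ∑ q ∈ G, e v q d + (Real.log Q - 1))) π :=
    fun v => (((integrable_finsetSum _ fun q hq => hei v q hq).const_mul _).add
      (integrable_const _)).const_mul _
  have hS : ∀ v, ∫ d, b v * (Q⁻¹ * ∑ q ∈ G, e v q d + (Real.log Q - 1)) ∂π
      ≤ b v * Real.log Q := by
    intro v
    rw [integral_const_mul, integral_add ((integrable_finsetSum _ fun q hq =>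
      hei v q hq).const_mul _) (integrable_const _), integral_const_mul,
      integral_finsetSum _ fun q hq => hei v q hq]
    refine mul_le_mul_of_nonneg_left ?_ (hb0 v)
    have h1 : ∑ q ∈ G, ∫ d, e v q d ∂π ≤ Q :=
      (Finset.sum_le_sum fun q hq => he1 v q hq).trans (by simpa using hGcard)
    have h2 : Q⁻¹ * ∑ q ∈ G, ∫ d, e v q d ∂π ≤ 1 := by
      rw [inv_mul_le_iff₀ hQ0, mul_one]; exact h1
    simp only [integral_const, probReal_univ, smul_eq_mul, one_mul]
    linarith
  have hpt : ∀ᵐ d ∂π,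
      cvOracleRisk P φ A fold d (mhat d) - cvOracleRisk P φ A fold d (mtilde d)
        ≤ 2 * (1 / (V : ℝ) * ∑ v, b v * (Q⁻¹ * ∑ q ∈ G, e v q d + (Real.log Q - 1)))
          + (8 * L * B + 16 * c * B ^ 2) * (K * M / n) := by
    filter_upwards [hB1, hB2, hhat, htilde] with d h1 h2 h3 h4
    obtain ⟨q, hq, q', hq', h⟩ := cvOracleRisk_sub_le hn hV hB0 hL hc hφ hlip hmod hA hblock
      h1 h2 h3 h4
    refine h.trans ?_
    gcongr with v _
    have hv : (0 : ℝ) < (block fold v).card := by exact_mod_cast hblock v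
    have := mul_le_sum_exp_add (W := fun q => W v q d) (l := τ * (block fold v).card)
      (Finset.mk_mem_product hq hq' : (q, q') ∈ G) hQ0
    simp only [b]
    rw [one_div_mul_eq_div, le_div_iff₀ (by positivity), mul_comm]
    exact this
  have hsi : Integrable (fun d =>
      ∑ v, b v * (Q⁻¹ * ∑ q ∈ G, e v q d + (Real.log Q - 1))) π :=
    integrable_finsetSum _ fun v _ => hSi v
  have hi2 : Integrable (fun d => 2 * (1 / (V : ℝ) *
      ∑ v, b v * (Q⁻¹ * ∑ q ∈ G, e v q d + (Real.log Q - 1)))) π := (hsi.const_mul _).const_mul _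
  have hi3 : Integrable (fun d => 2 * (1 / (V : ℝ) *
      ∑ v, b v * (Q⁻¹ * ∑ q ∈ G, e v q d + (Real.log Q - 1)))
        + (8 * L * B + 16 * c * B ^ 2) * (K * M / n)) π := hi2.add (integrable_const _)
  refine (integral_mono_ae (μ := π) ((integrable_cvOracleRisk hV hφc hA hB hmhat
    (hhat.mono fun _ h => h.1)).sub (integrable_cvOracleRisk hV hφc hA hB hmtilde
    (htilde.mono fun _ h => h.1))) hi3 hpt).trans ?_
  rw [integral_add hi2 (integrable_const _), integral_const_mul, integral_const_mul,
    integral_finsetSum _ fun v _ => hSi v]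
  simp only [integral_const, probReal_univ, smul_eq_mul, one_mul]
  gcongr with v _
  exact hS v

/-- The aggregation bound in terms of the block size `⌊n/V⌋`. -/
theorem integral_cvOracleRisk_sub_le_log (hK : 0 < K) (hV : 2 ≤ V) (hVn : V ≤ n) (hB0 : 0 < B)
    (hL : 0 < L) (hc : 0 < c) (hφ : ConvexOn ℝ Set.univ φ)
    (hlip : ∀ x ∈ Set.Icc (-B) B, ∀ y ∈ Set.Icc (-B) B, |φ x - φ y| ≤ L * |x - y|)
    (hmod : ∀ ε : ℝ, 0 < ε → ((c * ε ^ 2 : ℝ) : EReal) ≤ convexityModulus P φ B ε)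
    (hA : ∀ j v, Measurable fun q : (Fin n → 𝒳 × Fin K) × 𝒳 =>
      A j (trainMeasure fold q.1 v) q.2)
    (hB : ∀ᵐ d ∂(Measure.pi fun _ : Fin n => P), ∀ m ∈ stdSimplex ℝ (Fin M), ∀ v,
      SupBounded P B (foldScore A fold d m v))
    (hfold : IsRegularPartition fold)
    {mhat mtilde : (Fin n → 𝒳 × Fin K) → Fin M → ℝ}
    (hmhat : Measurable mhat) (hmtilde : Measurable mtilde)
    (hhat : ∀ᵐ d ∂(Measure.pi fun _ : Fin n => P), IsConvArgmin (cvEmpRisk φ A fold d) (mhat d))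
    (htilde : ∀ᵐ d ∂(Measure.pi fun _ : Fin n => P),
      IsConvArgmin (cvOracleRisk P φ A fold d) (mtilde d)) :
    ∫ d, (cvOracleRisk P φ A fold d (mhat d) - cvOracleRisk P φ A fold d (mtilde d))
        ∂(Measure.pi fun _ : Fin n => P)
      ≤ (8 / min (1 / (4 * L * B)) (c / L ^ 2) + 2 * (8 * L * B + 16 * c * B ^ 2)) *
        (K * M * Real.log n / ((n / V : ℕ) : ℝ)) := by
  -- With τ = c₀/K, the two entries of the minimum are exactly the boundedness and the variance
  -- constraints on τ.
  set c₀ := min (1 / (4 * L * B)) (c / L ^ 2) with hc₀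
  have hc₀pos : 0 < c₀ := lt_min (by positivity) (by positivity)
  have hK' : (0 : ℝ) < K := by exact_mod_cast hK
  have hV' : (0 : ℝ) < V := by exact_mod_cast (by omega : 0 < V)
  have hn2 : 2 ≤ n := hV.trans hVn
  have hn' : (0 : ℝ) < n := by exact_mod_cast (by omega : 0 < n)
  have hr : 0 < n / V := Nat.div_pos hVn (by omega)
  set r : ℝ := ((n / V : ℕ) : ℝ) with hrdef
  have hr' : 0 < r := by rw [hrdef]; exact_mod_cast hr
  have hcard : ∀ v, n / V ≤ (block fold v).card := fun v => by
    rcases hfold v with h | h <;> omega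
  have h1 : c₀ / K * (4 * K * L * B) ≤ 1 := by
    have : c₀ * (4 * L * B) ≤ 1 := by
      rw [← le_div_iff₀ (by positivity)]; exact min_le_left _ _
    calc c₀ / K * (4 * K * L * B) = c₀ * (4 * L * B) := by field_simp
      _ ≤ 1 := this
  have h2 : c₀ / K * (L ^ 2 * K) ≤ c := by
    have : c₀ * L ^ 2 ≤ c := by
      rw [← le_div_iff₀ (by positivity)]; exact min_le_right _ _
    calc c₀ / K * (L ^ 2 * K) = c₀ * L ^ 2 := by field_simp
      _ ≤ c := this
  refine (integral_cvOracleRisk_sub_le (by omega) (by omega) hB0.le hL.le hc.le hφ hlip hmod hA hB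
    (fun v => hr.trans_le (hcard v)) (div_pos hc₀pos hK') h1 h2 hmhat hmtilde hhat htilde).trans ?_
  -- As n ≥ 2, log n ≥ 1/2 and n + 1 ≤ n². This absorbs the grid cardinality and the discretization
  -- error of order KM/n into KM log n / ⌊n/V⌋.
  have hlog0 : 0 ≤ Real.log n := Real.log_natCast_nonneg n
  have hlog2 : 1 / 2 ≤ Real.log n := by
    have : Real.log 2 ≤ Real.log n := Real.log_le_log two_pos (by exact_mod_cast hn2)
    linarith [Real.log_two_gt_d9]
  have hlogn : Real.log (n + 1 : ℝ) ≤ 2 * Real.log n := by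
    rw [← Nat.cast_two, ← Real.log_pow]
    refine Real.log_le_log (by positivity) ?_
    have : (2 : ℝ) ≤ n := by exact_mod_cast hn2
    nlinarith
  have hlogQ : Real.log ((((n + 1) ^ M) ^ 2 : ℕ) : ℝ) ≤ 4 * M * Real.log n := by
    push_cast
    rw [Real.log_pow, Real.log_pow]
    push_cast
    have := mul_le_mul_of_nonneg_left hlogn (Nat.cast_nonneg M : (0 : ℝ) ≤ M)
    linarith
  have hsum : 1 / (V : ℝ) * ∑ v, 1 / (c₀ / K * (block fold v).card) *
      Real.log ((((n + 1) ^ M) ^ 2 : ℕ) : ℝ) ≤ K / (c₀ * r) * (4 * M * Real.log n) := by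
    have hv : ∀ v, 1 / (c₀ / K * (block fold v).card) *
        Real.log ((((n + 1) ^ M) ^ 2 : ℕ) : ℝ) ≤ K / (c₀ * r) * (4 * M * Real.log n) := by
      intro v
      have hb : r ≤ (block fold v).card := by rw [hrdef]; exact_mod_cast hcard v
      have : 1 / (c₀ / K * (block fold v).card) = K / (c₀ * (block fold v).card) := by
        have := hr'.trans_le hb
        field_simp
      rw [this]
      gcongr
    calc _ ≤ 1 / (V : ℝ) * ∑ _v : Fin V, K / (c₀ * r) * (4 * M * Real.log n) :=
          mul_le_mul_of_nonneg_left (Finset.sum_le_sum fun v _ => hv v) (by positivity)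
      _ = _ := by simp only [Finset.sum_const, Finset.card_univ, Fintype.card_fin, nsmul_eq_mul]
                  field_simp
  have hrn : r ≤ n := by rw [hrdef]; exact_mod_cast Nat.div_le_self n V
  have herr : (K * M / n : ℝ) ≤ 2 * (K * M * Real.log n / r) := by
    calc (K * M / n : ℝ) ≤ K * M / r := by gcongr
      _ ≤ K * M * (2 * Real.log n) / r :=
          div_le_div_of_nonneg_right
            (le_mul_of_one_le_right (by positivity) (by linarith)) hr'.le
      _ = _ := by ring
  have h3 : 0 ≤ 8 * L * B + 16 * c * B ^ 2 := by positivity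
  have h4 := mul_le_mul_of_nonneg_left herr h3
  have h5 : 2 * (K / (c₀ * r) * (4 * M * Real.log n)) = 8 / c₀ * (K * M * Real.log n / r) := by
    field_simp; ring
  have h6 : (8 / c₀ + 2 * (8 * L * B + 16 * c * B ^ 2)) * (K * M * Real.log n / r)
      = 8 / c₀ * (K * M * Real.log n / r)
        + (8 * L * B + 16 * c * B ^ 2) * (2 * (K * M * Real.log n / r)) := by ring
  rw [h6, ← h5]
  exact add_le_add (mul_le_mul_of_nonneg_left hsum zero_le_two) h4

end ExpectedOracleInequality

/-! ### Conditional excess risk of the cross-validated set -/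

section ExcessRisk

variable {𝒳 : Type*} [MeasurableSpace 𝒳] {K n N V M : ℕ} {fold : Fin n → Fin V}
  {A : Fin M → ScoreAlgorithm 𝒳 K} {φ : ℝ → ℝ} {B β α s c₂ c₃ : ℝ} {fstar : Score 𝒳 K}
  {P : Measure (𝒳 × Fin K)} [IsProbabilityMeasure P]

theorem measurable_risk_empConfSet {Ω : Type*} [MeasurableSpace Ω] {u : Ω → Fin N → 𝒳}
    {f : Ω → Score 𝒳 K} (hu : Measurable u)
    (hf : ∀ k, Measurable fun q : Ω × 𝒳 => f q.1 q.2 k) :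
    Measurable fun ω => risk P (empConfSet (u ω) (f ω) β) := by
  have hS : MeasurableSet {w : Ω × (𝒳 × Fin K) |
      w.2.2 ∉ empConfSet (u w.1) (f w.1) β w.2.1} := by
    have hk : ∀ k, MeasurableSet {w : Ω × (𝒳 × Fin K) |
        empTailSum (u w.1) (f w.1) (f w.1 w.2.1 k) ≤ β} := fun k =>
      measurableSet_le (measurable_empTailSum_uncurry
        ((hf k).comp (measurable_fst.prodMk (measurable_fst.comp measurable_snd))) fun i k' =>
          (hf k').comp (measurable_fst.prodMk
            ((measurable_pi_apply i).comp (hu.comp measurable_fst)))) measurable_const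
    have : {w : Ω × (𝒳 × Fin K) | w.2.2 ∉ empConfSet (u w.1) (f w.1) β w.2.1}
        = ⋃ k, {w | w.2.2 = k} ∩ {w | empTailSum (u w.1) (f w.1) (f w.1 w.2.1 k) ≤ β}ᶜ := by
      ext w
      simp [empConfSet, levelSet]
    rw [this]
    exact MeasurableSet.iUnion fun k =>
      ((measurable_snd.comp measurable_snd) (measurableSet_singleton k)).inter (hk k).compl
  exact (measurable_measure_prodMk_left (ν := P) hS).ennreal_toReal

theorem cvExcessPhiRisk_nonneg (hV : 0 < V) (hφ : Continuous φ)
    (hmin : IsPhiRiskMinimizer P φ fstar)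
    (hA : ∀ j v, Measurable fun q : (Fin n → 𝒳 × Fin K) × 𝒳 =>
      A j (trainMeasure fold q.1 v) q.2)
    {d : Fin n → 𝒳 × Fin K} {m : Fin M → ℝ} (hB : ∀ v, SupBounded P B (foldScore A fold d m v)) :
    0 ≤ cvExcessPhiRisk P φ fstar A fold d m := by
  have hV' : (0 : ℝ) < V := by exact_mod_cast hV
  rw [cvExcessPhiRisk, sub_nonneg, cvOracleRisk, one_div_mul_eq_div, le_div_iff₀ hV', mul_comm]
  calc (V : ℝ) * phiRisk P φ fstar = ∑ _v : Fin V, phiRisk P φ fstar := by simp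
    _ ≤ _ := Finset.sum_le_sum fun v _ => hmin.2.2 _ (measurable_foldScore hA d m v)
        (integrable_scoreLoss hφ (measurable_foldScore hA d m v) (hB v))

variable [NeZero K]

theorem integrable_cvExcessRisk (hV : 0 < V)
    (hA : ∀ j v, Measurable fun q : (Fin n → 𝒳 × Fin K) × 𝒳 =>
      A j (trainMeasure fold q.1 v) q.2)
    {m : (Fin n → 𝒳 × Fin K) → Fin M → ℝ} (hm : Measurable m) :
    Integrable (fun q : (Fin n → 𝒳 × Fin K) × (Fin N → 𝒳) =>
        cvExcessRisk P β A fold q.1 q.2 (m q.1))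
      ((Measure.pi fun _ : Fin n => P).prod (Measure.pi fun _ : Fin N => P.fst)) := by
  have hmeas : Measurable fun q : (Fin n → 𝒳 × Fin K) × (Fin N → 𝒳) =>
      cvExcessRisk P β A fold q.1 q.2 (m q.1) :=
    (measurable_const.mul (Finset.measurable_sum _ fun v _ =>
      measurable_risk_empConfSet measurable_snd fun k => measurable_foldScore_uncurry hA
        (measurable_fst.comp measurable_fst) (hm.comp (measurable_fst.comp measurable_fst))
        measurable_snd v k)).sub measurable_const
  have hr : ∀ Γ : 𝒳 → Set (Fin K), |risk P Γ| ≤ 1 := fun Γ => by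
    rw [risk, abs_of_nonneg measureReal_nonneg]; exact measureReal_le_one
  refine Integrable.of_bound hmeas.aestronglyMeasurable (1 + 1)
    (Filter.Eventually.of_forall fun q => ?_)
  exact (abs_sub _ _).trans (add_le_add (abs_one_div_mul_sum_le hV fun v => hr _) (hr _))

theorem abs_cvExcessRisk_le (hV : 0 < V) (d : Fin n → 𝒳 × Fin K) (u : Fin N → 𝒳) (m : Fin M → ℝ) :
    |cvExcessRisk P β A fold d u m| ≤ 1 / (V : ℝ) *
      ∑ v, |risk P (empConfSet u (foldScore A fold d m v) β) - risk P (oracleSet P β)| := by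
  have hV' : (0 : ℝ) < V := by exact_mod_cast hV
  have : cvExcessRisk P β A fold d u m = 1 / (V : ℝ) *
      ∑ v, (risk P (empConfSet u (foldScore A fold d m v) β) - risk P (oracleSet P β)) := by
    rw [cvExcessRisk, Finset.sum_sub_distrib, Finset.sum_const, Finset.card_univ, Fintype.card_fin,
      nsmul_eq_mul]
    field_simp
  rw [this, abs_mul, abs_of_nonneg (by positivity)]
  gcongr
  exact Finset.abs_sum_le_sum_abs _ _

/-- With the labeled sample frozen, the triangle inequality passes through {f_k ≥ t₀(v)}, each fold
having its own population threshold. The bound remains affine in the excess φ-risk, with t free. -/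
theorem lintegral_abs_cvExcessRisk_le (hK : 0 < K) (hN : 1 ≤ N) (hV : 0 < V)
    (hφ : ConvexOn ℝ Set.univ φ) (hc₃ : 0 < c₃) (hs : 0 < s)
    (hβ0 : 0 < β) (hβK : β < K)
    (hA1 : ∀ k, Continuous (scoreCDF P (condProb P) k))
    (hmargin : ∀ k, MarginCondition P β α c₂ k) (hmin : IsPhiRiskMinimizer P φ fstar)
    {δstar : ℝ} (hcal : ∀ᵐ x ∂P.fst, thresholdSet fstar δstar x = oracleSet P β x)
    (hzhang : ∀ᵐ x ∂P.fst, ∀ k, |condProb P x k - tailInv P β| ^ s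
      ≤ c₃ * marginalExcess P φ fstar k (-δstar) x)
    (hA : ∀ j v, Measurable fun q : (Fin n → 𝒳 × Fin K) × 𝒳 =>
      A j (trainMeasure fold q.1 v) q.2)
    {d : Fin n → 𝒳 × Fin K} {m : Fin M → ℝ} (hB : ∀ v, SupBounded P B (foldScore A fold d m v))
    (hc : ∀ v k, Continuous (scoreCDF P (foldScore A fold d m v) k))
    {t : ℝ} (ht : 0 < t) :
    ∫⁻ u : Fin N → 𝒳, ENNReal.ofReal |cvExcessRisk P β A fold d u m|
        ∂(Measure.pi fun _ : Fin N => P.fst)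
      ≤ ENNReal.ofReal (4 * (K / Real.sqrt N)
        + 2 * (K * (c₂ * t ^ α) + c₃ / t ^ s * cvExcessPhiRisk P φ fstar A fold d m)) := by
  have hV' : (0 : ℝ) < V := by exact_mod_cast hV
  have hfm := fun v => measurable_foldScore hA d m v
  choose t₀ ht₀ using fun v => exists_tailSum_eq (hfm v) (hc v) hβ0 hβK
  let a : Fin V → (Fin N → 𝒳) → ℝ := fun v u =>
    |risk P (empConfSet u (foldScore A fold d m v) β)
      - risk P (thresholdSet (foldScore A fold d m v) (-t₀ v))|
  let b : Fin V → ℝ := fun v =>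
    2 * (K * (c₂ * t ^ α) + c₃ / t ^ s * (phiRisk P φ (foldScore A fold d m v) - phiRisk P φ fstar))
  have hb : ∀ v, |risk P (thresholdSet (foldScore A fold d m v) (-t₀ v))
      - risk P (oracleSet P β)| ≤ b v := fun v =>
    abs_risk_thresholdSet_sub_oracle_le hφ hc₃ hs hβ0 hβK hA1 hmargin hmin hcal hzhang (hfm v)
      (hB v) (hc v) (ht₀ v) ht
  have hb0 : ∀ v, 0 ≤ b v := fun v => (abs_nonneg _).trans (hb v)
  have hbsum : 1 / (V : ℝ) * ∑ v, b v
      = 2 * (K * (c₂ * t ^ α) + c₃ / t ^ s * cvExcessPhiRisk P φ fstar A fold d m) := by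
    simp only [b, cvExcessPhiRisk, cvOracleRisk, ← Finset.mul_sum, Finset.sum_add_distrib,
      Finset.sum_sub_distrib, Finset.sum_const, Finset.card_univ, Fintype.card_fin, nsmul_eq_mul]
    field_simp
  have hpt : ∀ u, ENNReal.ofReal |cvExcessRisk P β A fold d u m|
      ≤ ENNReal.ofReal (1 / (V : ℝ)) * ∑ v, ENNReal.ofReal (a v u)
        + ENNReal.ofReal (1 / (V : ℝ) * ∑ v, b v) := by
    intro u
    rw [← ENNReal.ofReal_sum_of_nonneg fun v _ => abs_nonneg _,
      ← ENNReal.ofReal_mul (by positivity), ← ENNReal.ofReal_add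
        (mul_nonneg (by positivity) (Finset.sum_nonneg fun v _ => abs_nonneg _))
        (mul_nonneg (by positivity) (Finset.sum_nonneg fun v _ => hb0 v)), ← mul_add,
      ← Finset.sum_add_distrib]
    refine ENNReal.ofReal_le_ofReal ((abs_cvExcessRisk_le hV d u m).trans ?_)
    refine mul_le_mul_of_nonneg_left (Finset.sum_le_sum fun v _ => ?_) (by positivity)
    exact (abs_sub_le _ (risk P (thresholdSet (foldScore A fold d m v) (-t₀ v))) _).trans
      (add_le_add le_rfl (hb v))
  have ham : ∀ v, Measurable fun u => ENNReal.ofReal (a v u) := by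
    intro v
    have h1 : Measurable fun u : Fin N → 𝒳 => risk P (empConfSet u (foldScore A fold d m v) β) :=
      measurable_risk_empConfSet measurable_id fun k =>
        (measurable_score_apply (hfm v) k).comp measurable_snd
    exact (h1.sub_const _).abs.ennreal_ofReal
  calc ∫⁻ u : Fin N → 𝒳, ENNReal.ofReal |cvExcessRisk P β A fold d u m|
        ∂(Measure.pi fun _ : Fin N => P.fst)
      ≤ ∫⁻ u : Fin N → 𝒳, (ENNReal.ofReal (1 / (V : ℝ)) * ∑ v, ENNReal.ofReal (a v u)
        + ENNReal.ofReal (1 / (V : ℝ) * ∑ v, b v)) ∂(Measure.pi fun _ : Fin N => P.fst) :=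
        lintegral_mono hpt
    _ = ENNReal.ofReal (1 / (V : ℝ)) * ∑ v, ∫⁻ u, ENNReal.ofReal (a v u)
          ∂(Measure.pi fun _ : Fin N => P.fst) + ENNReal.ofReal (1 / (V : ℝ) * ∑ v, b v) := by
        rw [lintegral_add_right _ measurable_const, lintegral_const_mul _
          (Finset.measurable_sum _ fun v _ => ham v), lintegral_finsetSum _ fun v _ => ham v]
        simp
    _ ≤ ENNReal.ofReal (1 / (V : ℝ)) * ∑ _v : Fin V, ENNReal.ofReal (4 * (K / Real.sqrt N))
          + ENNReal.ofReal (1 / (V : ℝ) * ∑ v, b v) := by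
        gcongr with v _
        exact lintegral_abs_risk_empConfSet_sub_le hK hN (hfm v) (hc v) (ht₀ v)
    _ = ENNReal.ofReal (4 * (K / Real.sqrt N) + 1 / (V : ℝ) * ∑ v, b v) := by
        have h4 : 0 ≤ 4 * (K / Real.sqrt N) := by positivity
        rw [ENNReal.ofReal_add h4
          (mul_nonneg (by positivity) (Finset.sum_nonneg fun v _ => hb0 v)),
          ← ENNReal.ofReal_sum_of_nonneg fun v _ => h4, ← ENNReal.ofReal_mul (by positivity)]
        congr 2
        rw [Finset.sum_const, Finset.card_univ, Fintype.card_fin, nsmul_eq_mul]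
        field_simp
    _ = _ := by rw [hbsum]

/-- The choice t = (X/κ)^(1/(α+s)) equates κ t^α with X t^(-s). -/
theorem rate_balance {κ X α s : ℝ} (hκ : 0 < κ) (hX : 0 < X) (hα : 0 < α) (hs : 0 < s) :
    ∃ t : ℝ, 0 < t ∧ κ * t ^ α = κ ^ (1 - α / (α + s)) * X ^ (α / (α + s)) ∧
      X / t ^ s = κ ^ (1 - α / (α + s)) * X ^ (α / (α + s)) := by
  have hαs : α + s ≠ 0 := by positivity
  have hXκ : 0 < X / κ := by positivity
  refine ⟨(X / κ) ^ (1 / (α + s)), Real.rpow_pos_of_pos hXκ _, ?_, ?_⟩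
  · rw [← Real.rpow_mul hXκ.le, one_div_mul_eq_div, Real.div_rpow hX.le hκ.le,
      Real.rpow_sub hκ, Real.rpow_one]
    ring
  · have h1 : s / (α + s) = 1 - α / (α + s) := by field_simp; ring
    have h2 : X / X ^ (s / (α + s)) = X ^ (α / (α + s)) := by
      have : α / (α + s) = 1 - s / (α + s) := by rw [h1]; ring
      rw [this, Real.rpow_sub hX, Real.rpow_one]
    rw [← Real.rpow_mul hXκ.le, one_div_mul_eq_div, Real.div_rpow hX.le hκ.le, ← h2, ← h1]
    field_simp

end ExcessRisk

end ConfSet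

/-! ### Integration over both samples and choice of the margin scale -/

theorem proposition7 :
    -- the absolute constant
    ∃ C' : ℝ, 0 < C' ∧
    ∀ B L α s c₁ c₂ c₃ : ℝ, 0 < B → 0 < L → 0 < α → 1 ≤ s → 0 < c₁ → 0 < c₂ → 0 < c₃ →
    ∃ C : ℝ, 0 < C ∧
    ∀ (𝒳 : Type*) [MeasurableSpace 𝒳] (K : ℕ) [NeZero K] (_hK : 2 ≤ K)
      (P : Measure (𝒳 × Fin K)) [IsProbabilityMeasure P]
      (β : ℝ) (_hβ0 : 0 < β) (_hβK : β < K)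
      -- continuity of the distribution functions of the `p_k(X)`, and margin conditions
      (_hA1 : ∀ k, Continuous (ConfSet.scoreCDF P (ConfSet.condProb P) k))
      (_hmargin : ∀ k, ConfSet.MarginCondition P β α c₂ k)
      -- the loss
      (φ : ℝ → ℝ) (_hconv : ConvexOn ℝ Set.univ φ)
      (_hlip : ∀ x ∈ Set.Icc (-B) B, ∀ y ∈ Set.Icc (-B) B, |φ x - φ y| ≤ L * |x - y|)
      (_hmod : ∀ ε : ℝ, 0 < ε →
        ((c₁ * ε ^ 2 : ℝ) : EReal) ≤ ConfSet.convexityModulus P φ B ε)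
      -- the minimizer of the `φ`-risk, calibration, and the calibration inequality
      (fstar : ConfSet.Score 𝒳 K) (_hfstar : ConfSet.IsPhiRiskMinimizer P φ fstar)
      (δstar : ℝ)
      (_hcal : ∀ᵐ x ∂P.fst, ConfSet.thresholdSet fstar δstar x = ConfSet.oracleSet P β x)
      (_hzhang : ∀ᵐ x ∂P.fst, ∀ k,
        |ConfSet.condProb P x k - ConfSet.tailInv P β| ^ s
          ≤ c₃ * ConfSet.marginalExcess P φ fstar k (-δstar) x)
      -- the samples, the folds and the score algorithms
      (n N V M : ℕ) (_hV : 2 ≤ V) (_hVn : V ≤ n) (_hN : 1 ≤ N)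
      (fold : Fin n → Fin V) (_hfold : ConfSet.IsRegularPartition fold)
      (A : Fin M → ConfSet.ScoreAlgorithm 𝒳 K)
      (_hA : ∀ j v, Measurable fun q : (Fin n → 𝒳 × Fin K) × 𝒳 =>
        A j (ConfSet.trainMeasure fold q.1 v) q.2)
      (_hB : ∀ᵐ d ∂(Measure.pi fun _ : Fin n => P), ∀ m ∈ stdSimplex ℝ (Fin M), ∀ v,
        ConfSet.SupBounded P B (ConfSet.foldScore A fold d m v))
      -- the cross-validated score and its oracle counterpart, through their convex weights
      (mhat mtilde : (Fin n → 𝒳 × Fin K) → Fin M → ℝ)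
      (_hmhat : Measurable mhat) (_hmtilde : Measurable mtilde)
      (_hhat : ∀ᵐ d ∂(Measure.pi fun _ : Fin n => P),
        ConfSet.IsConvArgmin (ConfSet.cvEmpRisk φ A fold d) (mhat d))
      (_htilde : ∀ᵐ d ∂(Measure.pi fun _ : Fin n => P),
        ConfSet.IsConvArgmin (ConfSet.cvOracleRisk P φ A fold d) (mtilde d))
      -- continuity of the distribution functions of the cross-validated scores
      (_hA2 : ∀ᵐ d ∂(Measure.pi fun _ : Fin n => P), ∀ v k,
        Continuous (ConfSet.scoreCDF P (ConfSet.foldScore A fold d (mhat d) v) k)),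
      Integrable (fun q : (Fin n → 𝒳 × Fin K) × (Fin N → 𝒳) =>
          ConfSet.cvExcessRisk P β A fold q.1 q.2 (mhat q.1))
        ((Measure.pi fun _ : Fin n => P).prod (Measure.pi fun _ : Fin N => P.fst)) ∧
      Integrable (fun d : Fin n → 𝒳 × Fin K =>
          ConfSet.cvExcessPhiRisk P φ fstar A fold d (mtilde d))
        (Measure.pi fun _ : Fin n => P) ∧
      ∫ q : (Fin n → 𝒳 × Fin K) × (Fin N → 𝒳),
          |ConfSet.cvExcessRisk P β A fold q.1 q.2 (mhat q.1)|
          ∂((Measure.pi fun _ : Fin n => P).prod (Measure.pi fun _ : Fin N => P.fst))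
        ≤ C * (K : ℝ) ^ (1 - α / (α + s)) *
            ((∫ d : Fin n → 𝒳 × Fin K, ConfSet.cvExcessPhiRisk P φ fstar A fold d (mtilde d)
                ∂(Measure.pi fun _ : Fin n => P))
              + K * M * Real.log n / ((n / V : ℕ) : ℝ)) ^ (α / (α + s))
          + C' * (K / Real.sqrt N) := by
  refine ⟨4, by norm_num, ?_⟩
  intro B L α s c₁ c₂ c₃ hB0 hL hα hs hc₁ hc₂ hc₃
  set C₂ : ℝ := 8 / min (1 / (4 * L * B)) (c₁ / L ^ 2) + 2 * (8 * L * B + 16 * c₁ * B ^ 2) with hC₂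
  have hC₂0 : 0 ≤ C₂ := by positivity
  -- After balancing, the margin term contributes c₂ and the excess φ-risk term c₃(1 + C₂), where C₂
  -- is the aggregation constant; the factor 2 comes from the symmetric difference.
  refine ⟨2 * (c₂ + c₃ * (1 + C₂)), by positivity, ?_⟩
  intro 𝒳 _ K _ hK P _ β hβ0 hβK hA1 hmargin φ hφ hlip hmod fstar hmin δstar hcal hzhang
    n N V M hV hVn hN fold hfold A hA hB mhat mtilde hmhat hmtilde hhat htilde hA2
  have hs0 : 0 < s := by linarith
  have hK0 : 0 < K := by omega
  have hV0 : 0 < V := by omega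
  have hφc := ConfSet.continuous_of_convexOn_univ hφ
  have hIrisk := ConfSet.integrable_cvExcessRisk (P := P) (β := β) (N := N) hV0 hA hmhat
  have hIhat := ConfSet.integrable_cvOracleRisk hV0 hφc hA hB hmhat (hhat.mono fun _ h => h.1)
  have hItilde := ConfSet.integrable_cvOracleRisk hV0 hφc hA hB hmtilde
    (htilde.mono fun _ h => h.1)
  have hIehat : Integrable (fun d => ConfSet.cvExcessPhiRisk P φ fstar A fold d (mhat d))
      (Measure.pi fun _ : Fin n => P) := hIhat.sub (integrable_const _)
  have hIetilde : Integrable (fun d => ConfSet.cvExcessPhiRisk P φ fstar A fold d (mtilde d))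
      (Measure.pi fun _ : Fin n => P) := hItilde.sub (integrable_const _)
  refine ⟨hIrisk, hIetilde, ?_⟩
  -- The simplex on no vertices is empty, so a minimizer cannot exist for M = 0. Positivity of M
  -- makes the remainder `R` positive, hence E + R > 0 as balancing requires.
  have hM : 0 < M := by
    obtain ⟨d, hd⟩ := hhat.exists
    rcases Nat.eq_zero_or_pos M with rfl | h
    · have := hd.1.2
      simp at this
    · exact h
  have hK' : (0 : ℝ) < K := by exact_mod_cast hK0
  have hM' : (0 : ℝ) < M := by exact_mod_cast hM
  have hr' : (0 : ℝ) < ((n / V : ℕ) : ℝ) := by exact_mod_cast Nat.div_pos hVn hV0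
  have hlog : 0 < Real.log n := Real.log_pos (by exact_mod_cast (by omega : 1 < n))
  set R : ℝ := K * M * Real.log n / ((n / V : ℕ) : ℝ) with hR
  have hR0 : 0 < R := by positivity
  set E : ℝ := ∫ d, ConfSet.cvExcessPhiRisk P φ fstar A fold d (mtilde d)
    ∂(Measure.pi fun _ : Fin n => P) with hE
  have hE0 : 0 ≤ E := integral_nonneg_of_ae (by
    filter_upwards [hB, htilde] with d h1 h2
    exact ConfSet.cvExcessPhiRisk_nonneg hV0 hφc hmin hA (h1 _ h2.1))
  have hehat0 : ∀ᵐ d ∂(Measure.pi fun _ : Fin n => P),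
      0 ≤ ConfSet.cvExcessPhiRisk P φ fstar A fold d (mhat d) := by
    filter_upwards [hB, hhat] with d h1 h2
    exact ConfSet.cvExcessPhiRisk_nonneg hV0 hφc hmin hA (h1 _ h2.1)
  have hEhat : ∫ d, ConfSet.cvExcessPhiRisk P φ fstar A fold d (mhat d)
      ∂(Measure.pi fun _ : Fin n => P) ≤ (1 + C₂) * (E + R) := by
    have h1 := ConfSet.integral_cvOracleRisk_sub_le_log hK0 hV hVn hB0 hL hc₁ hφ hlip hmod hA hB
      hfold hmhat hmtilde hhat htilde
    have h2 : ∫ d, ConfSet.cvExcessPhiRisk P φ fstar A fold d (mhat d)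
        ∂(Measure.pi fun _ : Fin n => P) - E
        = ∫ d, (ConfSet.cvOracleRisk P φ A fold d (mhat d)
          - ConfSet.cvOracleRisk P φ A fold d (mtilde d)) ∂(Measure.pi fun _ : Fin n => P) := by
      rw [hE, ← integral_sub hIehat hIetilde]
      refine integral_congr_ae (Filter.Eventually.of_forall fun d => ?_)
      simp only [ConfSet.cvExcessPhiRisk]
      ring
    rw [← h2, ← hC₂, ← hR] at h1
    linarith [mul_nonneg hC₂0 hE0]
  have hX0 : 0 < E + R := by linarith
  -- The scale t depends only on K and on the expected quantity E + R, not on the data; concavity of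
  -- the final power and Jensen's inequality are not needed.
  obtain ⟨t, ht, ht1, ht2⟩ := ConfSet.rate_balance hK' hX0 hα hs0
  have hts : 0 < t ^ s := Real.rpow_pos_of_pos ht s
  have hmain : ∫ q : (Fin n → 𝒳 × Fin K) × (Fin N → 𝒳),
        |ConfSet.cvExcessRisk P β A fold q.1 q.2 (mhat q.1)|
        ∂((Measure.pi fun _ : Fin n => P).prod (Measure.pi fun _ : Fin N => P.fst))
      ≤ ∫ d, (4 * (K / Real.sqrt N) + 2 * (K * (c₂ * t ^ α)
        + c₃ / t ^ s * ConfSet.cvExcessPhiRisk P φ fstar A fold d (mhat d)))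
        ∂(Measure.pi fun _ : Fin n => P) := by
    rw [integral_prod _ hIrisk.abs]
    refine integral_mono_ae hIrisk.abs.integral_prod_left ((integrable_const _).add
      (((integrable_const _).add (hIehat.const_mul _)).const_mul _)) ?_
    filter_upwards [hB, hhat, hA2, hehat0, hIrisk.abs.prod_right_ae] with d h1 h2 h3 h4 h5
    have hbd : 0 ≤ 4 * (K / Real.sqrt N) + 2 * (K * (c₂ * t ^ α)
        + c₃ / t ^ s * ConfSet.cvExcessPhiRisk P φ fstar A fold d (mhat d)) := by positivity
    refine (ENNReal.ofReal_le_ofReal_iff hbd).1 ?_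
    rw [ofReal_integral_eq_lintegral_ofReal h5 (Filter.Eventually.of_forall fun _ => abs_nonneg _)]
    exact ConfSet.lintegral_abs_cvExcessRisk_le hK0 hN hV0 hφ hc₃ hs0 hβ0 hβK hA1 hmargin
      hmin hcal hzhang hA (h1 _ h2.1) h3 ht
  refine hmain.trans ?_
  have hi1 : Integrable (fun d => c₃ / t ^ s *
      ConfSet.cvExcessPhiRisk P φ fstar A fold d (mhat d)) (Measure.pi fun _ : Fin n => P) :=
    hIehat.const_mul _
  have hi2 : Integrable (fun d => 2 * (K * (c₂ * t ^ α) + c₃ / t ^ s *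
      ConfSet.cvExcessPhiRisk P φ fstar A fold d (mhat d))) (Measure.pi fun _ : Fin n => P) :=
    ((integrable_const _).add hi1).const_mul _
  rw [integral_add (integrable_const _) hi2, integral_const_mul 2,
    integral_add (integrable_const _) hi1, integral_const_mul (c₃ / t ^ s)]
  simp only [integral_const, probReal_univ, smul_eq_mul, one_mul]
  have h6 : c₃ / t ^ s * ∫ d, ConfSet.cvExcessPhiRisk P φ fstar A fold d (mhat d)
      ∂(Measure.pi fun _ : Fin n => P) ≤ c₃ * (1 + C₂) * ((E + R) / t ^ s) := by
    calc _ ≤ c₃ / t ^ s * ((1 + C₂) * (E + R)) := by gcongr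
      _ = _ := by ring
  rw [ht2] at h6
  have h7 : K * (c₂ * t ^ α) = c₂ * (K * t ^ α) := by ring
  rw [h7, ht1]
  linarith
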